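/- Let $\mathbb D$ be the open unit disc and $\mathcal H(\mathbb D)$ the holomorphic functions on it. For $f\in\mathcal H(\mathbb D)$, $0<r<1$, let $M_p(f,r)=\big(\int_0^{2\pi}|f(re^{i\theta})|^p\frac{d\theta}{2\pi}\big)^{1/p}$ for $0<p<\infty$ and $M_\infty(f,r)=\max_\theta|f(re^{i\theta})|$. For $0<p\le\infty$ and $\gamma>0$ let $H(p,q,\gamma)$ be the space of $f\in\mathcal H(\mathbb D)$ with $\|f\|_{(p,q,\gamma)}<\infty$, where $\|f\|_{(p,q,\gamma)}=\big(\int_0^1(1-r)^{\gamma q-1}M_p^q(f,r)\,dr\big)^{1/q}$ if $0<q<\infty$ and $\|f\|_{(p,\infty,\gamma)}=\sup_{0<r<1}(1-r)^\gamma M_p(f,r)$. Let $A^\infty_\gamma$ be the space of $f\in\mathcal H(\mathbb D)$ with $\sup_{z\in\mathbb D}(1-|z|)^\gamma|f(z)|<\infty$, normed by this supremum. Let $\mu$ be a finite positive Borel measure on $[0,1)$ and, for $\beta>0$ and $f\in\mathcal H(\mathbb D)$, put $$\mathcal C_{\mu,\beta}f(z)=\int_0^1\frac{f(tz)}{(1-tz)^\beta}\,d\mu(t),\qquad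 z\in\mathbb D.$$ For $s>0$, $\mu$ is called an $s$-Carleson measure if there is $C>0$ with $\mu([r,1))\le C(1-r)^s$ for all $0\le r<1$. A linear operator $T$ between two of these spaces $X\to Y$ is bounded if it maps $X$ into $Y$ and $\|Tf\|_Y\le C\|f\|_X$ for all $f\in X$, with $C$ independent of $f$. \textbf{Theorem.} Let $\gamma_1,\gamma_2,\beta>0$ with $\gamma_2<\gamma_1+\beta$. The following statements are equivalent. (i) $\mathcal C_{\mu,\beta}:A^\infty_{\gamma_1}\to A^\infty_{\gamma_2}$ is bounded. (ii) $\mu$ is a $(\beta+\gamma_1-\gamma_2)$-Carleson measure. (iii) $\mathcal C_{\mu,\beta}:H(p,\infty,\gamma_1)\to H(p,\infty,\gamma_2)$ is bounded for all $1\le p\le\infty$. (iv) $\mathcal C_{\mu,\beta}:H(p,q,\gamma_1)\to H(p,q,\gamma_2)$ is bounded for all $1\le p<\infty$ and $0<q<\infty$. (v) $\mathcal C_{\mu,\beta}:H(p,q,\gamma_1)\to H(p,q,\gamma_2)$ is bounded for some $1\le p<\infty$ and $0<q<\infty$. (vi) $\mathcal C_{\mu,\beta+\delta}:H(p,q,\gamma_1-\delta)\to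 H(p,q,\gamma_2)$ is bounded for some $1\le p<\infty$, $0<\delta<\gamma_1$ and $0<q<\infty$. -/

import Mathlib

open MeasureTheory Set
open scoped ENNReal NNReal

noncomputable section

/-- `f` is holomorphic on the open unit disc. Only the values of `f` on the disc matter. -/
def HolDisc (f : ℂ → ℂ) : Prop :=
  DifferentiableOn ℂ f (Metric.ball (0 : ℂ) 1)

/-- The normalized arc length `dθ / 2π` on `(0, 2π]`. -/
def arcMeasure : Measure ℝ :=
  (ENNReal.ofReal (2 * Real.pi))⁻¹ • volume.restrict (Ioc 0 (2 * Real.pi))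

/-- The integral means `M_p(f, r) = (∫ |f(r e^{iθ})|^p dθ/2π)^{1/p}`, and
`M_∞(f, r)`, the (essential) supremum of `|f|` over the circle of radius `r`. -/
def integralMean (p : ℝ≥0∞) (f : ℂ → ℂ) (r : ℝ) : ℝ≥0∞ :=
  eLpNorm (fun θ : ℝ => f (circleMap 0 r θ)) p arcMeasure

/-- The mixed (quasi-)norm of `H(p, q, γ)`:
`(∫_0^1 (1 - r)^{γ q - 1} M_p(f, r)^q dr)^{1/q}` if `q < ∞`, and
`sup_{0 < r < 1} (1 - r)^γ M_p(f, r)` if `q = ∞`. -/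
def mixedNorm (p q : ℝ≥0∞) (γ : ℝ) (f : ℂ → ℂ) : ℝ≥0∞ :=
  if q = ∞ then
    ⨆ r ∈ Ioo (0 : ℝ) 1, ENNReal.ofReal ((1 - r) ^ γ) * integralMean p f r
  else
    (∫⁻ r in Ioo (0 : ℝ) 1,
      ENNReal.ofReal ((1 - r) ^ (γ * q.toReal - 1)) * integralMean p f r ^ q.toReal)
        ^ (1 / q.toReal)

/-- The norm `sup_{|z| < 1} (1 - |z|)^γ |f(z)|` of the Korenblum space `A^∞_γ`. -/
def korenblumNorm (γ : ℝ) (f : ℂ → ℂ) : ℝ≥0∞ :=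
  ⨆ z ∈ Metric.ball (0 : ℂ) 1, ENNReal.ofReal ((1 - ‖z‖) ^ γ) * ‖f z‖ₑ

/-- The Cesàro-type operator `C_{μ,β} f(z) = ∫ f(tz) / (1 - tz)^β dμ(t)`
(principal branch of the power). -/
def cesaroOp (μ : Measure ℝ) (β : ℝ) (f : ℂ → ℂ) (z : ℂ) : ℂ :=
  ∫ t : ℝ, f ((t : ℂ) * z) / (1 - (t : ℂ) * z) ^ (β : ℂ) ∂μ

/-- `T` is bounded from the space of holomorphic functions on the disc with `N₁ f < ∞` to the
space of holomorphic functions on the disc with finite `N₂`. -/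
def IsBoundedBetween (T : (ℂ → ℂ) → (ℂ → ℂ)) (N₁ N₂ : (ℂ → ℂ) → ℝ≥0∞) : Prop :=
  ∃ C : ℝ≥0, ∀ f : ℂ → ℂ, HolDisc f → N₁ f < ∞ → HolDisc (T f) ∧ N₂ (T f) ≤ C * N₁ f

/-- `μ` is an `s`-Carleson measure on `[0, 1)`: `μ([r, 1)) ≤ C (1 - r)^s` for `0 ≤ r < 1`. -/
def IsCarleson (μ : Measure ℝ) (s : ℝ) : Prop :=
  ∃ C : ℝ, 0 < C ∧ ∀ r ∈ Ico (0 : ℝ) 1, μ (Ico r 1) ≤ ENNReal.ofReal (C * (1 - r) ^ s)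

end

/-! ### Poisson integrals and integral means -/

/-! All six statements reduce to the Carleson condition with exponent `s = β + γ₁ - γ₂`. It sees `β`
and `γ₁` only through their sum, so trading `δ` between kernel and weight changes nothing.

Sufficiency. On a circle the operator averages the dilations `f (t ·)` against a kernel of size at
most `(1 - t r)^(-β)`, so Minkowski's inequality gives `M_p(C f, r) ≤ ∫ M_p(f, t r) (1 - t r)^(-β)
dμ(t)` (`integralMean_cesaroOp_le`). The Carleson condition enters through `∫ (1 - t r)^(-b) dμ(t) ≲
(1 - r)^(s - b)` for `b > s` (`IsCarleson.exists_lintegral_le`). For the supremum norms one inserts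
the growth bound `(1 - x)^(-γ₁)` and takes `b = β + γ₁`. For `q < ∞` that bound is too lossy: `(1 -
r)^(-γ₂)` just fails to be integrable. Instead a running maximum of `M_p(f, x) (1 - x)^a` with `a <
γ₁` is pulled out, `b = β + a` is used, and the maximum is controlled by a Hardy type inequality
valid for every `q > 0` (`exists_lintegral_iSup_rpow_le`). This uses that `M_p` increases with the
radius.

Necessity. The functions `(1 - ρ z)^(-m)` are evaluated at `z = ρ`, where the integrand is positive
and of size at least a constant times `(1 - ρ)^(-m-β)` on `[ρ, 1)` (`le_enorm_cesaroOp_testFun`).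
Upper bounds for their norms (`korenblumNorm_testFun_le`, `exists_mixedNorm_testFun_le`) and
pointwise growth in the target space then bound `μ([ρ, 1))`. -/

lemma norm_cpow_ofReal {z : ℂ} (hz : z ≠ 0) (b : ℝ) : ‖z ^ (b : ℂ)‖ = ‖z‖ ^ b := by
  rw [Complex.norm_cpow_of_ne_zero hz]
  simp

instance isProbabilityMeasure_arcMeasure : IsProbabilityMeasure arcMeasure := by
  constructor
  have h : ENNReal.ofReal (2 * Real.pi) ≠ 0 := by
    simp [Real.pi_pos]
  simp only [arcMeasure, Measure.smul_apply, Measure.restrict_apply MeasurableSet.univ, univ_inter,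
    Real.volume_Ioc, sub_zero, smul_eq_mul]
  exact ENNReal.inv_mul_cancel h ENNReal.ofReal_ne_top

lemma circleAverage_eq_integral_arcMeasure {E : Type*} [NormedAddCommGroup E] [NormedSpace ℝ E]
    (g : ℂ → E) (R : ℝ) :
    Real.circleAverage g 0 R = ∫ θ, g (circleMap 0 R θ) ∂arcMeasure := by
  rw [Real.circleAverage_def, arcMeasure, integral_smul_measure,
    intervalIntegral.integral_of_le Real.two_pi_pos.le, ENNReal.toReal_inv,
    ENNReal.toReal_ofReal Real.two_pi_pos.le]

lemma HolDisc.continuousOn {f : ℂ → ℂ} (hf : HolDisc f) : ContinuousOn f (Metric.ball 0 1) :=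
  DifferentiableOn.continuousOn hf

lemma HolDisc.continuous_circleMap {f : ℂ → ℂ} (hf : HolDisc f) {r : ℝ} (h0 : 0 ≤ r)
    (h1 : r < 1) : Continuous fun θ : ℝ => f (circleMap 0 r θ) := by
  refine hf.continuousOn.comp_continuous (_root_.continuous_circleMap 0 r) fun θ => ?_
  simpa [abs_of_nonneg h0] using h1

lemma HolDisc.diffContOnCl {f : ℂ → ℂ} (hf : HolDisc f) {R : ℝ} (h1 : R < 1) :
    DiffContOnCl ℂ f (Metric.ball 0 R) := by
  refine DifferentiableOn.diffContOnCl (DifferentiableOn.mono hf ?_)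
  exact Metric.closure_ball_subset_closedBall.trans (Metric.closedBall_subset_ball h1)

/-- The density on the circle of radius `R` of the harmonic measure at `w`. -/
noncomputable def poissonDensity (R : ℝ) (w : ℂ) (θ : ℝ) : ℝ≥0∞ :=
  ENNReal.ofReal (poissonKernel 0 w (circleMap 0 R θ))

lemma norm_circleMap_sub_pos {R : ℝ} {w : ℂ} (hw : ‖w‖ < R) (θ : ℝ) :
    R - ‖w‖ ≤ ‖circleMap 0 R θ - w‖ ∧ 0 < ‖circleMap 0 R θ - w‖ := by
  have hR : 0 < R := (norm_nonneg w).trans_lt hw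
  have h : ‖circleMap 0 R θ‖ = R := by simp [abs_of_pos hR]
  have := norm_sub_norm_le (circleMap 0 R θ) w
  rw [h] at this
  exact ⟨this, by linarith⟩

lemma poissonKernel_circleMap {R : ℝ} (w : ℂ) (θ : ℝ) :
    poissonKernel 0 w (circleMap 0 R θ) = (R ^ 2 - ‖w‖ ^ 2) / ‖circleMap 0 R θ - w‖ ^ 2 := by
  simp [poissonKernel_def]

lemma continuous_poissonKernel_circleMap {R : ℝ} {w : ℂ} (hw : ‖w‖ < R) :
    Continuous fun θ : ℝ => poissonKernel 0 w (circleMap 0 R θ) := by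
  simp_rw [poissonKernel_circleMap]
  refine Continuous.div (by fun_prop) (by fun_prop) fun θ => ?_
  exact (pow_pos (norm_circleMap_sub_pos hw θ).2 2).ne'

lemma poissonKernel_circleMap_nonneg {R : ℝ} {w : ℂ} (hw : ‖w‖ < R) (θ : ℝ) :
    0 ≤ poissonKernel 0 w (circleMap 0 R θ) := by
  rw [poissonKernel_circleMap]
  have := norm_nonneg w
  exact div_nonneg (by nlinarith) (by positivity)

lemma poissonKernel_circleMap_le {R : ℝ} {w : ℂ} (hw : ‖w‖ < R) (θ : ℝ) :
    poissonKernel 0 w (circleMap 0 R θ) ≤ (R + ‖w‖) / (R - ‖w‖) := by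
  rw [poissonKernel_circleMap]
  have h0 := norm_nonneg w
  obtain ⟨h1, h2⟩ := norm_circleMap_sub_pos hw θ
  have h3 : 0 < R - ‖w‖ := by linarith
  rw [div_le_div_iff₀ (by positivity) h3]
  have h4 : (R - ‖w‖) ^ 2 ≤ ‖circleMap 0 R θ - w‖ ^ 2 := by gcongr
  nlinarith [mul_le_mul_of_nonneg_left h4 (by linarith : 0 ≤ R + ‖w‖)]

lemma measurable_poissonDensity {R : ℝ} {w : ℂ} (hw : ‖w‖ < R) :
    Measurable (poissonDensity R w) :=
  ENNReal.measurable_ofReal.comp (continuous_poissonKernel_circleMap hw).measurable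

lemma integrable_arcMeasure_of_continuous {E : Type*} [NormedAddCommGroup E]
    {g : ℝ → E}
    (hg : Continuous g) : Integrable g arcMeasure := by
  refine Integrable.smul_measure ?_ ?_
  · exact (hg.integrableOn_Icc (a := 0) (b := 2 * Real.pi)).mono_set Ioc_subset_Icc_self
  · simp [Real.pi_pos]

lemma lintegral_poissonDensity {R : ℝ} {w : ℂ} (hw : ‖w‖ < R) :
    ∫⁻ θ, poissonDensity R w θ ∂arcMeasure = 1 := by
  have h := (diffContOnCl_const (c := (1 : ℂ)) (s := Metric.ball 0 R)
    (𝕜 := ℂ)).circleAverage_poissonKernel_smul (w := w) (by simpa using hw)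
  rw [circleAverage_eq_integral_arcMeasure] at h
  have h' : ((∫ θ, poissonKernel 0 w (circleMap 0 R θ) ∂arcMeasure : ℝ) : ℂ) = 1 := by
    rw [← h, ← integral_complex_ofReal]
    simp
  have h2 : ∫ θ, poissonKernel 0 w (circleMap 0 R θ) ∂arcMeasure = 1 := by exact_mod_cast h'
  rw [show (1 : ℝ≥0∞) = ENNReal.ofReal 1 by simp, ← h2, ofReal_integral_eq_lintegral_ofReal]
  · rfl
  · exact integrable_arcMeasure_of_continuous (continuous_poissonKernel_circleMap hw)
  · exact .of_forall (poissonKernel_circleMap_nonneg hw)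

/-- The harmonic measure at `w` on the circle of radius `R`. -/
noncomputable def harmonicMeasure (R : ℝ) (w : ℂ) : Measure ℝ :=
  arcMeasure.withDensity (poissonDensity R w)

lemma isProbabilityMeasure_harmonicMeasure {R : ℝ} {w : ℂ} (hw : ‖w‖ < R) :
    IsProbabilityMeasure (harmonicMeasure R w) := by
  constructor
  rw [harmonicMeasure, withDensity_apply _ MeasurableSet.univ, Measure.restrict_univ,
    lintegral_poissonDensity hw]

lemma harmonicMeasure_le {R : ℝ} {w : ℂ} (hw : ‖w‖ < R) :
    harmonicMeasure R w ≤ ENNReal.ofReal ((R + ‖w‖) / (R - ‖w‖)) • arcMeasure := by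
  rw [← withDensity_const]
  exact withDensity_mono (.of_forall fun θ =>
    ENNReal.ofReal_le_ofReal (poissonKernel_circleMap_le hw θ))

lemma HolDisc.enorm_le_lintegral_harmonicMeasure {f : ℂ → ℂ} (hf : HolDisc f) {R : ℝ} {w : ℂ}
    (hw : ‖w‖ < R) (h1 : R < 1) :
    ‖f w‖ₑ ≤ ∫⁻ θ, ‖f (circleMap 0 R θ)‖ₑ ∂harmonicMeasure R w := by
  have hR : 0 < R := (norm_nonneg w).trans_lt hw
  have h := (hf.diffContOnCl h1).circleAverage_poissonKernel_smul (w := w) (by simpa using hw)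
  rw [circleAverage_eq_integral_arcMeasure] at h
  rw [← h, harmonicMeasure, lintegral_withDensity_eq_lintegral_mul _ (measurable_poissonDensity hw)
    (hf.continuous_circleMap hR.le h1).enorm.measurable]
  refine (enorm_integral_le_lintegral_enorm _).trans (lintegral_mono fun θ => ?_)
  simp only [Pi.smul_apply', enorm_smul, Pi.mul_apply, poissonDensity]
  rw [Real.enorm_of_nonneg (poissonKernel_circleMap_nonneg hw θ)]

/-- Harmonic measure has mass one, so the `L^1` bound from Poisson's formula improves to every `p ≥
1`. Both the monotonicity of the means and the pointwise growth estimates come from this. -/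
lemma HolDisc.enorm_le_eLpNorm_harmonicMeasure {f : ℂ → ℂ} (hf : HolDisc f) {R : ℝ} {w : ℂ}
    (hw : ‖w‖ < R) (h1 : R < 1) {p : ℝ≥0∞} (hp : 1 ≤ p) :
    ‖f w‖ₑ ≤ eLpNorm (fun θ => f (circleMap 0 R θ)) p (harmonicMeasure R w) := by
  have hR : 0 < R := (norm_nonneg w).trans_lt hw
  have := isProbabilityMeasure_harmonicMeasure hw
  refine (hf.enorm_le_lintegral_harmonicMeasure hw h1).trans ?_
  rw [← eLpNorm_one_eq_lintegral_enorm]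
  exact eLpNorm_le_eLpNorm_of_exponent_le hp
    (hf.continuous_circleMap hR.le h1).aestronglyMeasurable

/-- The Poisson kernel is at most the Harnack constant, which costs its `1/p`-th power. For `p = ∞`
the exponent is `0` and this is the maximum principle. -/
lemma HolDisc.enorm_le_integralMean {f : ℂ → ℂ} (hf : HolDisc f) {R : ℝ} {w : ℂ}
    (hw : ‖w‖ < R) (h1 : R < 1) {p : ℝ≥0∞} (hp : 1 ≤ p) :
    ‖f w‖ₑ ≤ ENNReal.ofReal ((R + ‖w‖) / (R - ‖w‖)) ^ (1 / p).toReal * integralMean p f R := by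
  refine (hf.enorm_le_eLpNorm_harmonicMeasure hw h1 hp).trans ?_
  refine (eLpNorm_mono_measure _ (harmonicMeasure_le hw)).trans_eq ?_
  have h0 := norm_nonneg w
  rw [eLpNorm_smul_measure_of_ne_zero, integralMean, smul_eq_mul]
  simp only [ne_eq, ENNReal.ofReal_eq_zero, not_le]
  exact div_pos (by linarith) (by linarith)

lemma integralMean_rpow {p : ℝ≥0∞} (hp : 1 ≤ p) (hp' : p < ∞) (f : ℂ → ℂ) (r : ℝ) :
    integralMean p f r ^ p.toReal = ∫⁻ θ, ‖f (circleMap 0 r θ)‖ₑ ^ p.toReal ∂arcMeasure := by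
  have h0 : p ≠ 0 := (zero_lt_one.trans_le hp).ne'
  have h1 : p.toReal ≠ 0 := (ENNReal.toReal_pos h0 hp'.ne).ne'
  rw [integralMean, eLpNorm_eq_lintegral_rpow_enorm_toReal h0 hp'.ne, ← ENNReal.rpow_mul,
    one_div_mul_cancel h1, ENNReal.rpow_one]

/-- By the law of cosines the distance depends on the angles only through `cos (θ - α)`. The
resulting symmetry of the Poisson kernel lets its mass be computed in either angle. -/
lemma norm_circleMap_sub_circleMap_comm (r R θ α : ℝ) :
    ‖circleMap 0 R θ - circleMap 0 r α‖ = ‖circleMap 0 R α - circleMap 0 r θ‖ := by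
  have h : ∀ x y : ℝ, ‖circleMap 0 R x - circleMap 0 r y‖ ^ 2
      = R ^ 2 + r ^ 2 - 2 * R * r * (Real.cos x * Real.cos y + Real.sin x * Real.sin y) := by
    intro x y
    rw [← Complex.normSq_eq_norm_sq, Complex.normSq_apply]
    simp only [circleMap, Complex.exp_mul_I, ← Complex.ofReal_cos, ← Complex.ofReal_sin,
      Complex.add_re, Complex.add_im, Complex.sub_re, Complex.sub_im, Complex.mul_re,
      Complex.mul_im, Complex.ofReal_re, Complex.ofReal_im, Complex.I_re, Complex.I_im,
      Complex.zero_re, Complex.zero_im]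
    linear_combination R ^ 2 * Real.sin_sq_add_cos_sq x + r ^ 2 * Real.sin_sq_add_cos_sq y
  have h2 := (h θ α).trans ((by ring : _ = _).trans (h α θ).symm)
  exact (pow_left_inj₀ (norm_nonneg _) (norm_nonneg _) two_ne_zero).1 h2

lemma poissonDensity_circleMap_comm (r R θ α : ℝ) :
    poissonDensity R (circleMap 0 r α) θ = poissonDensity R (circleMap 0 r θ) α := by
  simp only [poissonDensity, poissonKernel_circleMap]
  rw [norm_circleMap_sub_circleMap_comm]
  simp

lemma measurable_uncurry_poissonDensity {r R : ℝ} (h0 : 0 ≤ r) (h : r < R) :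
    Measurable (fun x : ℝ × ℝ => poissonDensity R (circleMap 0 r x.1) x.2) := by
  refine ENNReal.measurable_ofReal.comp (Continuous.measurable ?_)
  simp_rw [poissonKernel_circleMap]
  refine Continuous.div ?_ ?_ fun x => ?_
  · simp only [circleMap]; fun_prop
  · simp only [circleMap]; fun_prop
  · exact (pow_pos (norm_circleMap_sub_pos (by simpa [abs_of_nonneg h0] using h) _).2 2).ne'

/-- `|f|^p` on the inner circle is dominated by its Poisson average over the outer one. After
Tonelli, the symmetry of the kernel makes the inner integral equal to one. -/
lemma HolDisc.integralMean_mono {f : ℂ → ℂ} (hf : HolDisc f) {p : ℝ≥0∞} (hp : 1 ≤ p)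
    (hp' : p < ∞) {r R : ℝ} (h0 : 0 ≤ r) (h : r ≤ R) (h1 : R < 1) :
    integralMean p f r ≤ integralMean p f R := by
  obtain rfl | h := h.eq_or_lt
  · rfl
  have hp0 : p ≠ 0 := (zero_lt_one.trans_le hp).ne'
  have hp1 : 0 < p.toReal := ENNReal.toReal_pos hp0 hp'.ne
  have hw : ∀ α, ‖circleMap 0 r α‖ < R := fun α => by simpa [abs_of_nonneg h0] using h
  rw [← ENNReal.rpow_le_rpow_iff hp1, integralMean_rpow hp hp', integralMean_rpow hp hp']
  have hR : 0 < R := h0.trans_lt h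
  have hm : Measurable fun θ : ℝ => ‖f (circleMap 0 R θ)‖ₑ ^ p.toReal :=
    (hf.continuous_circleMap hR.le h1).enorm.measurable.pow_const _
  calc ∫⁻ α, ‖f (circleMap 0 r α)‖ₑ ^ p.toReal ∂arcMeasure
      ≤ ∫⁻ α, ∫⁻ θ, poissonDensity R (circleMap 0 r α) θ *
          ‖f (circleMap 0 R θ)‖ₑ ^ p.toReal ∂arcMeasure ∂arcMeasure := by
        refine lintegral_mono fun α => ?_
        refine (ENNReal.rpow_le_rpow (hf.enorm_le_eLpNorm_harmonicMeasure (hw α) h1 hp)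
          hp1.le).trans_eq ?_
        rw [eLpNorm_eq_lintegral_rpow_enorm_toReal hp0 hp'.ne, ← ENNReal.rpow_mul,
          one_div_mul_cancel hp1.ne', ENNReal.rpow_one, harmonicMeasure,
          lintegral_withDensity_eq_lintegral_mul _ (measurable_poissonDensity (hw α)) hm]
        rfl
    _ = ∫⁻ θ, ∫⁻ α, poissonDensity R (circleMap 0 r α) θ *
          ‖f (circleMap 0 R θ)‖ₑ ^ p.toReal ∂arcMeasure ∂arcMeasure := by
        refine lintegral_lintegral_swap (Measurable.aemeasurable ?_)
        exact (measurable_uncurry_poissonDensity h0 h).mul (hm.comp measurable_snd)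
    _ = ∫⁻ θ, ‖f (circleMap 0 R θ)‖ₑ ^ p.toReal ∂arcMeasure := by
        refine lintegral_congr fun θ => ?_
        simp_rw [poissonDensity_circleMap_comm r R θ]
        rw [lintegral_mul_const _ (measurable_poissonDensity (hw θ)),
          lintegral_poissonDensity (hw θ), one_mul]

/-- **Minkowski's integral inequality** for nonnegative functions. -/
theorem lintegral_lintegral_rpow_le {α β : Type*} [MeasurableSpace α] [MeasurableSpace β]
    {μ : Measure α} {ν : Measure β} [SFinite μ] [SFinite ν] {F : α → β → ℝ≥0∞}
    (hF : Measurable (Function.uncurry F)) {p : ℝ} (hp : 1 ≤ p)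
    (hfin : ∫⁻ a, (∫⁻ b, F a b ∂ν) ^ p ∂μ ≠ ∞) :
    (∫⁻ a, (∫⁻ b, F a b ∂ν) ^ p ∂μ) ^ (1 / p) ≤ ∫⁻ b, (∫⁻ a, F a b ^ p ∂μ) ^ (1 / p) ∂ν := by
  obtain rfl | hp := hp.eq_or_lt
  · simp only [ENNReal.rpow_one, div_one]
    exact (lintegral_lintegral_swap hF.aemeasurable).le
  set G : α → ℝ≥0∞ := fun a => ∫⁻ b, F a b ∂ν with hG
  have hGm : Measurable G := hF.lintegral_prod_right'
  set I := ∫⁻ a, G a ^ p ∂μ with hI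
  obtain h0 | h0 := eq_or_ne I 0
  · rw [h0, ENNReal.zero_rpow_of_pos (by positivity)]
    exact zero_le
  have hc : p.HolderConjugate (p / (p - 1)) := Real.HolderConjugate.conjExponent hp
  have hp1 : 0 < p - 1 := by linarith
  -- Duality: one factor of `G ^ p` is expanded as an integral over `b`, and Hölder in `a` with
  -- exponents `p` and `p / (p - 1)` is applied for each fixed `b`. The power of `I` on the right is
  -- then divided out, which is where its finiteness matters.
  have key : I ≤ (∫⁻ b, (∫⁻ a, F a b ^ p ∂μ) ^ (1 / p) ∂ν) * I ^ (1 / (p / (p - 1))) := by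
    calc I = ∫⁻ a, ∫⁻ b, F a b * G a ^ (p - 1) ∂ν ∂μ := by
          refine lintegral_congr fun a => ?_
          rw [lintegral_mul_const _ (f := F a) (hF.comp measurable_prodMk_left)]
          change G a ^ p = G a * G a ^ (p - 1)
          nth_rewrite 2 [← ENNReal.rpow_one (G a)]
          rw [← ENNReal.rpow_add_of_nonneg _ _ zero_le_one hp1.le]
          congr 1; ring
      _ = ∫⁻ b, ∫⁻ a, F a b * G a ^ (p - 1) ∂μ ∂ν :=
          lintegral_lintegral_swap
            (hF.mul ((hGm.pow_const _).comp measurable_fst)).aemeasurable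
      _ ≤ ∫⁻ b, (∫⁻ a, F a b ^ p ∂μ) ^ (1 / p) * I ^ (1 / (p / (p - 1))) ∂ν := by
          refine lintegral_mono fun b => ?_
          refine (ENNReal.lintegral_mul_le_Lp_mul_Lq μ hc
            (hF.comp measurable_prodMk_right).aemeasurable
            (hGm.pow_const (p - 1)).aemeasurable).trans_eq ?_
          congr 2
          refine lintegral_congr fun a => ?_
          rw [← ENNReal.rpow_mul]
          congr 1; field_simp
      _ = _ := by
          refine lintegral_mul_const _ ?_
          refine Measurable.pow_const ?_ _
          exact Measurable.lintegral_prod_left' (f := fun x : α × β => F x.1 x.2 ^ p)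
            (hF.pow_const p)
  have hne : I ^ (1 / (p / (p - 1))) ≠ 0 := by
    simp [ENNReal.rpow_eq_zero_iff, h0, hfin]
  have hnt : I ^ (1 / (p / (p - 1))) ≠ ∞ := ENNReal.rpow_ne_top_of_nonneg (by positivity) hfin
  rw [← ENNReal.div_le_iff hne hnt] at key
  refine le_trans (le_of_eq ?_) key
  nth_rewrite 2 [← ENNReal.rpow_one I]
  rw [← ENNReal.rpow_sub _ _ h0 hfin]
  congr 1
  field_simp
  ring

/-! ### Weighted integrals on `(0, 1)` -/

/-- The weight `(1 - x) ^ c` with values in `[0, ∞]`. -/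
noncomputable def discWeight (c x : ℝ) : ℝ≥0∞ := ENNReal.ofReal ((1 - x) ^ c)

@[fun_prop]
lemma measurable_discWeight (c : ℝ) : Measurable (discWeight c) := by
  unfold discWeight; fun_prop

lemma discWeight_mul {x : ℝ} (hx : x < 1) (c d : ℝ) :
    discWeight c x * discWeight d x = discWeight (c + d) x := by
  have h : 0 < 1 - x := by linarith
  rw [discWeight, discWeight, discWeight, ← ENNReal.ofReal_mul (by positivity), Real.rpow_add h]

lemma discWeight_rpow {x : ℝ} (hx : x < 1) (c : ℝ) {q : ℝ} (hq : 0 ≤ q) :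
    discWeight c x ^ q = discWeight (c * q) x := by
  have h : 0 < 1 - x := by linarith
  rw [discWeight, discWeight, ENNReal.ofReal_rpow_of_nonneg (by positivity) hq, Real.rpow_mul h.le]

lemma discWeight_ne_top (c x : ℝ) : discWeight c x ≠ ∞ := ENNReal.ofReal_ne_top

lemma discWeight_mul_neg {x : ℝ} (hx : x < 1) (c : ℝ) :
    discWeight c x * discWeight (-c) x = 1 := by
  rw [discWeight_mul hx]; simp [discWeight]

lemma setLIntegral_discWeight {c u v : ℝ} (hc : 0 < c) (huv : u ≤ v) (hv : v ≤ 1) :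
    ∫⁻ x in Ioc u v, discWeight (c - 1) x
      = ENNReal.ofReal (((1 - u) ^ c - (1 - v) ^ c) / c) := by
  have hint : IntervalIntegrable (fun x : ℝ => (1 - x) ^ (c - 1)) volume u v := by
    have h := intervalIntegral.intervalIntegrable_rpow' (a := 1 - u) (b := 1 - v)
      (r := c - 1) (by linarith)
    simpa using h.comp_sub_left 1
  have hval : ∫ x in u..v, (1 - x) ^ (c - 1) = ((1 - u) ^ c - (1 - v) ^ c) / c := by
    rw [intervalIntegral.integral_comp_sub_left (fun x : ℝ => x ^ (c - 1)) 1,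
      integral_rpow (Or.inl (by linarith))]
    simp
  rw [← hval, intervalIntegral.integral_of_le huv, ofReal_integral_eq_lintegral_ofReal]
  · rfl
  · exact (intervalIntegrable_iff_integrableOn_Ioc_of_le huv).1 hint
  · refine (ae_restrict_mem measurableSet_Ioc).mono fun x hx => ?_
    exact Real.rpow_nonneg (by linarith [hx.2]) _

/-- The integrand is the derivative of `(1 - x r)^(-c)`; this is the layer-cake density for the
kernel. -/
lemma setLIntegral_deriv_one_sub_mul_rpow {r c t : ℝ} (hr0 : 0 ≤ r) (hr1 : r < 1) (hc : 0 < c)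
    (ht0 : 0 ≤ t) (ht1 : t ≤ 1) :
    ∫⁻ x in Ioc 0 t, ENNReal.ofReal (c * r * (1 - x * r) ^ (-c - 1))
      = ENNReal.ofReal ((1 - t * r) ^ (-c) - 1) := by
  have hpos : ∀ x ∈ Icc (0 : ℝ) t, 0 < 1 - x * r := fun x hx => by nlinarith [hx.1, hx.2]
  have hcont : ContinuousOn (fun x : ℝ => c * r * (1 - x * r) ^ (-c - 1)) (Icc 0 t) := by
    refine ContinuousOn.mul continuousOn_const (ContinuousOn.rpow_const (by fun_prop) ?_)
    exact fun x hx => Or.inl (hpos x hx).ne'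
  have hint : IntervalIntegrable (fun x : ℝ => c * r * (1 - x * r) ^ (-c - 1)) volume 0 t :=
    hcont.intervalIntegrable_of_Icc ht0
  have hval : ∫ x in (0 : ℝ)..t, c * r * (1 - x * r) ^ (-c - 1) = (1 - t * r) ^ (-c) - 1 := by
    rw [intervalIntegral.integral_eq_sub_of_hasDerivAt
      (f := fun x : ℝ => (1 - x * r) ^ (-c)) _ hint]
    · simp
    · intro x hx
      rw [uIcc_of_le ht0] at hx
      have h1 : HasDerivAt (fun x : ℝ => 1 - x * r) (-r) x := by
        simpa using ((hasDerivAt_id x).mul_const r).const_sub 1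
      refine (h1.rpow_const (p := -c) (Or.inl (hpos x hx).ne')).congr_deriv ?_
      ring
  rw [← hval, intervalIntegral.integral_of_le ht0, ofReal_integral_eq_lintegral_ofReal]
  · exact (intervalIntegrable_iff_integrableOn_Ioc_of_le ht0).1 hint
  · refine (ae_restrict_mem measurableSet_Ioc).mono fun x hx => ?_
    have := Real.rpow_pos_of_pos (hpos x (Ioc_subset_Icc_self hx)) (-c - 1)
    positivity

lemma IsCarleson.measure_Ici_le {μ : Measure ℝ} {C s : ℝ}
    (hμ : μ (Ico (0 : ℝ) 1)ᶜ = 0)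
    (hC : ∀ r ∈ Ico (0 : ℝ) 1, μ (Ico r 1) ≤ ENNReal.ofReal (C * (1 - r) ^ s)) {x : ℝ}
    (h0 : 0 ≤ x) (h1 : x ≤ 1) : μ (Ici x) ≤ ENNReal.ofReal (C * (1 - x) ^ s) := by
  obtain rfl | h1 := h1.eq_or_lt
  · refine le_trans (le_of_eq (measure_mono_null ?_ hμ)) zero_le
    intro y hy
    simp only [mem_compl_iff, mem_Ico, not_and, not_lt]
    exact fun _ => hy
  · refine le_trans ?_ (hC x ⟨h0, h1⟩)
    have : Ici x ⊆ Ico x 1 ∪ (Ico (0 : ℝ) 1)ᶜ := by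
      intro y hy
      by_cases h : y < 1
      · exact Or.inl ⟨hy, h⟩
      · exact Or.inr fun h' => h h'.2
    exact (measure_mono this).trans ((measure_union_le _ _).trans (by simp [hμ]))

/-- The standard integral estimate for Carleson measures on `[0, 1)`. -/
theorem IsCarleson.exists_lintegral_le {μ : Measure ℝ} [SFinite μ]
    (hμ : μ (Ico (0 : ℝ) 1)ᶜ = 0) {s b : ℝ} (hs : 0 ≤ s) (hb : s < b) (hc : IsCarleson μ s) :
    ∃ C : ℝ≥0, ∀ r ∈ Ico (0 : ℝ) 1,
      ∫⁻ t, discWeight (-b) (t * r) ∂μ ≤ C * discWeight (s - b) r := by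
  obtain ⟨C, hC0, hC⟩ := hc
  have hbs : 0 < b - s := by linarith
  have hb0 : 0 < b := by linarith
  -- The first `C` bounds the total mass of `μ`; the second term comes from integrating the tail
  -- bound `C (1 - x)^s` against the density.
  refine ⟨(C + C * b / (b - s)).toNNReal, fun r hr => ?_⟩
  obtain ⟨hr0, hr1⟩ := hr
  set g : ℝ → ℝ≥0∞ := fun x => ENNReal.ofReal (b * r * (1 - x * r) ^ (-b - 1)) with hg
  have hgm : Measurable g := by rw [hg]; fun_prop
  have hae : ∀ᵐ t ∂μ, t ∈ Ico (0 : ℝ) 1 := measure_eq_zero_iff_ae_notMem.1 hμ |>.mono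
    fun t ht => by simpa using ht
  have hμu : μ univ ≤ ENNReal.ofReal C := by
    have := IsCarleson.measure_Ici_le hμ hC le_rfl zero_le_one
    simp only [sub_zero, Real.one_rpow, mul_one] at this
    refine le_trans (le_of_eq ?_) this
    refine measure_congr (hae.mono fun t ht => ?_)
    exact propext ⟨fun _ => ht.1, fun _ => trivial⟩
  have hmS : MeasurableSet {z : ℝ × ℝ | z.2 ≤ z.1} := measurableSet_le measurable_snd measurable_fst
  -- Layer cake: `(1 - t r)^(-b)` is `1` plus the integral of `g` over `(0, t]`, and Tonelli turns
  -- the double integral into one of `g x` against the tail `μ [x, ∞)`.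
  calc ∫⁻ t, discWeight (-b) (t * r) ∂μ
      ≤ ∫⁻ t, (1 + ∫⁻ x in Ioc 0 1, {z : ℝ × ℝ | z.2 ≤ z.1}.indicator (fun z => g z.2) (t, x)) ∂μ := by
        refine lintegral_mono_ae (hae.mono fun t ht => ?_)
        have h1 : ∫⁻ x in Ioc 0 1, {z : ℝ × ℝ | z.2 ≤ z.1}.indicator (fun z => g z.2) (t, x)
            = ∫⁻ x in Ioc 0 t, g x := by
          rw [← lintegral_indicator measurableSet_Ioc, ← lintegral_indicator measurableSet_Ioc]
          refine lintegral_congr fun x => ?_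
          simp only [indicator, mem_ofPred_eq, mem_Ioc]
          have := ht.2
          split_ifs <;> first | rfl | (exfalso; grind)
        rw [h1, setLIntegral_deriv_one_sub_mul_rpow hr0 hr1 hb0 ht.1 ht.2.le, discWeight,
          show (1 : ℝ≥0∞) = ENNReal.ofReal 1 by simp]
        refine le_trans (ENNReal.ofReal_le_ofReal ?_) ENNReal.ofReal_add_le
        linarith
    _ = μ univ + ∫⁻ x in Ioc 0 1, ∫⁻ t, {z : ℝ × ℝ | z.2 ≤ z.1}.indicator (fun z => g z.2) (t, x) ∂μ := by
        rw [lintegral_add_left measurable_const, lintegral_const, one_mul]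
        congr 1
        refine lintegral_lintegral_swap (Measurable.aemeasurable ?_)
        exact (hgm.comp measurable_snd).indicator hmS
    _ = μ univ + ∫⁻ x in Ioc 0 1, g x * μ (Ici x) := by
        congr 1
        refine lintegral_congr fun x => ?_
        rw [← lintegral_indicator_const measurableSet_Ici]
        rfl
    _ ≤ ENNReal.ofReal C + ∫⁻ x in Ioc 0 1, ENNReal.ofReal (C * b / (b - s)) *
          ENNReal.ofReal ((b - s) * r * (1 - x * r) ^ (-(b - s) - 1)) := by
        refine add_le_add hμu (setLIntegral_mono' measurableSet_Ioc fun x hx => ?_)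
        refine (mul_le_mul_right (IsCarleson.measure_Ici_le hμ hC hx.1.le hx.2) _).trans ?_
        have hx1 : 0 < 1 - x * r := by nlinarith [hx.1, hx.2]
        rw [hg, ← ENNReal.ofReal_mul (by positivity), ← ENNReal.ofReal_mul (by positivity)]
        refine ENNReal.ofReal_le_ofReal ?_
        -- Weakening the tail bound in this way makes the integrand a multiple of the same kind of
        -- derivative, with `b` replaced by `b - s`.
        have h1 : (1 - x) ^ s ≤ (1 - x * r) ^ s :=
          Real.rpow_le_rpow (by linarith [hx.2]) (by nlinarith [hx.1]) hs
        have h2 : (1 - x * r) ^ (-(b - s) - 1) = (1 - x * r) ^ (-b - 1) * (1 - x * r) ^ s := by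
          rw [← Real.rpow_add hx1]; congr 1; ring
        rw [h2]
        calc b * r * (1 - x * r) ^ (-b - 1) * (C * (1 - x) ^ s)
            ≤ b * r * (1 - x * r) ^ (-b - 1) * (C * (1 - x * r) ^ s) := by gcongr
          _ = _ := by field_simp
    _ = ENNReal.ofReal C + ENNReal.ofReal (C * b / (b - s)) *
          ENNReal.ofReal ((1 - r) ^ (-(b - s)) - 1) := by
        rw [lintegral_const_mul _ (by fun_prop),
          setLIntegral_deriv_one_sub_mul_rpow hr0 hr1 hbs zero_le_one le_rfl, one_mul]
    _ ≤ _ := by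
        have h1 : 1 ≤ (1 - r) ^ (-(b - s)) :=
          Real.one_le_rpow_of_pos_of_le_one_of_nonpos (by linarith) (by linarith) (by linarith)
        have h2 : 0 ≤ C * b / (b - s) := by positivity
        rw [discWeight, ← ENNReal.ofReal_mul h2, ← ENNReal.ofReal_add hC0.le
          (mul_nonneg h2 (by linarith))]
        change _ ≤ ENNReal.ofReal _ * _
        rw [← ENNReal.ofReal_mul (by positivity), show s - b = -(b - s) by ring]
        refine ENNReal.ofReal_le_ofReal ?_
        nlinarith

/-- With this, the integral estimate for Carleson measures also handles the radial integrals in the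
mixed norms of the test functions. -/
lemma isCarleson_withDensity_discWeight {c : ℝ} (hc : 0 < c) :
    IsCarleson ((volume.restrict (Ioo (0 : ℝ) 1)).withDensity (discWeight (c - 1))) c := by
  refine ⟨1 / c, by positivity, fun r hr => ?_⟩
  rw [withDensity_apply _ measurableSet_Ico, Measure.restrict_restrict measurableSet_Ico]
  refine (lintegral_mono_set inter_subset_left).trans_eq ?_
  rw [restrict_Ico_eq_restrict_Ioc, setLIntegral_discWeight hc hr.2.le le_rfl, sub_self, Real.zero_rpow hc.ne']
  congr 1; ring

/-- A Hardy type inequality for the weighted running maximum of a monotone function. -/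
theorem exists_lintegral_iSup_rpow_le {a γ q : ℝ} (ha : 0 < a) (haγ : a < γ) (hq : 0 < q) :
    ∃ C : ℝ≥0, ∀ φ : ℝ → ℝ≥0∞, Monotone φ →
      ∫⁻ r in Ioo (0 : ℝ) 1, discWeight ((γ - a) * q - 1) r *
          (⨆ ρ ∈ Icc (0 : ℝ) r, φ ρ * discWeight a ρ) ^ q
        ≤ C * ∫⁻ r in Ioo (0 : ℝ) 1, discWeight (γ * q - 1) r * φ r ^ q := by
  have haq : 0 < a * q := by positivity
  have hgq : 0 < (γ - a) * q := mul_pos (by linarith) hq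
  -- Chosen so that `(1 - x)^(a q - 1)` integrates to `κ (1 - ρ)^(a q)` over `(ρ, (1 + ρ) / 2]`.
  set κ : ℝ := (1 - (1 / 2) ^ (a * q)) / (a * q) with hκ
  have hκ0 : 0 < κ := by
    refine div_pos ?_ haq
    have : (1 / 2 : ℝ) ^ (a * q) < 1 := Real.rpow_lt_one (by norm_num) (by norm_num) haq
    linarith
  refine ⟨(κ⁻¹ * (2 ^ ((γ - a) * q) / ((γ - a) * q))).toNNReal, fun φ hφ => ?_⟩
  have hφm : Measurable φ := hφ.measurable
  -- The region `x ≤ (1 + r) / 2`. It contains the interval `(ρ, (1 + ρ) / 2]` for every `ρ ≤ r`,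
  -- and for fixed `x` it leaves `r` in `[2 x - 1, 1)`, of length `2 (1 - x)`.
  set S : Set (ℝ × ℝ) := {z | 2 * z.2 - 1 ≤ z.1} with hS
  have hmS : MeasurableSet S := measurableSet_le (by fun_prop) measurable_fst
  set g : ℝ → ℝ≥0∞ := fun x => discWeight (a * q - 1) x * φ x ^ q with hg
  have hgm : Measurable g := (measurable_discWeight _).mul (hφm.pow_const q)
  -- By monotonicity `φ ρ` is at most `φ x` for `x` just to the right of `ρ`, so each competitor in
  -- the supremum is dominated by an integral that does not depend on `ρ`.
  have hsup : ∀ r ∈ Ioo (0 : ℝ) 1, (⨆ ρ ∈ Icc (0 : ℝ) r, φ ρ * discWeight a ρ) ^ q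
      ≤ ENNReal.ofReal κ⁻¹ * ∫⁻ x in Ioo (0 : ℝ) 1, S.indicator (fun z => g z.2) (r, x) := by
    intro r hr
    rw [← ENNReal.rpow_le_rpow_iff (inv_pos.2 hq), ← ENNReal.rpow_mul, mul_inv_cancel₀ hq.ne',
      ENNReal.rpow_one]
    refine iSup₂_le fun ρ hρ => ?_
    rw [ENNReal.le_rpow_inv_iff hq]
    have hρ1 : ρ < 1 := hρ.2.trans_lt hr.2
    rw [ENNReal.mul_rpow_of_nonneg _ _ hq.le, discWeight_rpow hρ1 _ hq.le]
    have hI : φ ρ ^ q * ENNReal.ofReal (κ * (1 - ρ) ^ (a * q))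
        ≤ ∫⁻ x in Ioo (0 : ℝ) 1, S.indicator (fun z => g z.2) (r, x) := by
      calc φ ρ ^ q * ENNReal.ofReal (κ * (1 - ρ) ^ (a * q))
          = ∫⁻ x in Ioc ρ ((1 + ρ) / 2), φ ρ ^ q * discWeight (a * q - 1) x := by
            rw [lintegral_const_mul _ (measurable_discWeight _),
              setLIntegral_discWeight haq (by linarith) (by linarith)]
            congr 2
            rw [show 1 - (1 + ρ) / 2 = (1 / 2) * (1 - ρ) by ring,
              Real.mul_rpow (by norm_num) (by linarith), hκ]
            ring
        _ ≤ ∫⁻ x in Ioc ρ ((1 + ρ) / 2), S.indicator (fun z => g z.2) (r, x) := by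
            refine setLIntegral_mono' measurableSet_Ioc fun x hx => ?_
            have : (r, x) ∈ S := by simp only [hS, mem_ofPred_eq]; linarith [hx.2, hρ.2]
            rw [indicator_of_mem this, mul_comm]
            exact mul_le_mul_right (ENNReal.rpow_le_rpow (hφ hx.1.le) hq.le) _
        _ ≤ _ := by
            refine lintegral_mono_set fun x hx => ?_
            exact ⟨hρ.1.trans_lt hx.1, hx.2.trans_lt (by linarith)⟩
    refine le_trans (le_of_eq ?_) (mul_le_mul_right hI _)
    rw [ENNReal.ofReal_mul hκ0.le, discWeight, mul_left_comm, ← mul_assoc (ENNReal.ofReal κ⁻¹),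
      ← ENNReal.ofReal_mul (inv_pos.2 hκ0).le, inv_mul_cancel₀ hκ0.ne', ENNReal.ofReal_one, one_mul]
  calc ∫⁻ r in Ioo (0 : ℝ) 1, discWeight ((γ - a) * q - 1) r *
          (⨆ ρ ∈ Icc (0 : ℝ) r, φ ρ * discWeight a ρ) ^ q
      ≤ ∫⁻ r in Ioo (0 : ℝ) 1, ENNReal.ofReal κ⁻¹ * ∫⁻ x in Ioo (0 : ℝ) 1,
          discWeight ((γ - a) * q - 1) r * S.indicator (fun z => g z.2) (r, x) := by
        refine setLIntegral_mono' measurableSet_Ioo fun r hr => ?_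
        rw [lintegral_const_mul' _ _ (discWeight_ne_top _ _), mul_left_comm]
        exact mul_le_mul_right (hsup r hr) _
    _ = ENNReal.ofReal κ⁻¹ * ∫⁻ x in Ioo (0 : ℝ) 1, ∫⁻ r in Ioo (0 : ℝ) 1,
          discWeight ((γ - a) * q - 1) r * S.indicator (fun z => g z.2) (r, x) := by
        rw [lintegral_const_mul' _ _ ENNReal.ofReal_ne_top]
        congr 1
        refine lintegral_lintegral_swap (Measurable.aemeasurable ?_)
        exact ((measurable_discWeight _).comp measurable_fst).mul
          ((hgm.comp measurable_snd).indicator hmS)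
    _ ≤ ENNReal.ofReal κ⁻¹ * ∫⁻ x in Ioo (0 : ℝ) 1,
          ENNReal.ofReal (2 ^ ((γ - a) * q) / ((γ - a) * q)) *
            (discWeight (γ * q - 1) x * φ x ^ q) := by
        gcongr ENNReal.ofReal κ⁻¹ * ?_
        refine setLIntegral_mono' measurableSet_Ioo fun x hx => ?_
        have h1 : ∫⁻ r in Ioo (0 : ℝ) 1,
            discWeight ((γ - a) * q - 1) r * S.indicator (fun z => g z.2) (r, x)
            ≤ ∫⁻ r in Ioc (2 * x - 1) 1, discWeight ((γ - a) * q - 1) r * g x := by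
          rw [← restrict_Ico_eq_restrict_Ioc, ← lintegral_indicator measurableSet_Ioo,
            ← lintegral_indicator measurableSet_Ico]
          refine lintegral_mono fun r => ?_
          simp only [indicator, hS, mem_ofPred_eq, mem_Ioo, mem_Ico]
          split_ifs <;> first | exact le_rfl | (exfalso; grind) | simp
        refine h1.trans ?_
        rw [lintegral_mul_const _ (measurable_discWeight _),
          setLIntegral_discWeight hgq (by linarith [hx.2]) le_rfl, sub_self,
          Real.zero_rpow hgq.ne', sub_zero, show 1 - (2 * x - 1) = 2 * (1 - x) by ring,
          Real.mul_rpow (by norm_num) (by linarith [hx.2]), mul_div_right_comm,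
          ENNReal.ofReal_mul (by positivity), mul_assoc]
        change _ * (discWeight _ x * (discWeight _ x * _)) ≤ _
        rw [← mul_assoc (discWeight _ x), discWeight_mul hx.2]
        refine le_of_eq ?_
        congr 3
        ring
    _ = _ := by
        rw [lintegral_const_mul' _ _ ENNReal.ofReal_ne_top, ← mul_assoc,
          ← ENNReal.ofReal_mul (inv_pos.2 hκ0).le]
        rfl

/-! ### The Cesàro-type operator -/

lemma one_sub_ne_zero_of_norm_lt_one {w : ℂ} (hw : ‖w‖ < 1) : 1 - w ≠ 0 := by
  intro h
  rw [sub_eq_zero] at h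
  simp [← h] at hw

lemma one_sub_mem_slitPlane {w : ℂ} (hw : ‖w‖ < 1) : 1 - w ∈ Complex.slitPlane := by
  left
  have := (Complex.re_le_norm w).trans_lt hw
  simpa using this

lemma HolDisc.div_one_sub_cpow {f : ℂ → ℂ} (hf : HolDisc f) (b : ℝ) :
    HolDisc fun w => f w / (1 - w) ^ (b : ℂ) := by
  refine DifferentiableOn.div hf ?_ fun w hw => ?_
  · refine DifferentiableOn.cpow (by fun_prop) (by fun_prop) fun w hw => ?_
    exact one_sub_mem_slitPlane (by simpa using hw)
  · exact (Complex.cpow_ne_zero_iff.2 (Or.inl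
      (one_sub_ne_zero_of_norm_lt_one (by simpa using hw))))

lemma ae_mem_Ico {μ : Measure ℝ} (hμ : μ (Ico (0 : ℝ) 1)ᶜ = 0) : ∀ᵐ t ∂μ, t ∈ Ico (0 : ℝ) 1 :=
  (measure_eq_zero_iff_ae_notMem.1 hμ).mono fun t ht => by simpa using ht

lemma norm_ofReal_mul_le {t : ℝ} (ht : t ∈ Ico (0 : ℝ) 1) (z : ℂ) : ‖(t : ℂ) * z‖ ≤ ‖z‖ := by
  rw [norm_mul, Complex.norm_real, Real.norm_of_nonneg ht.1]
  exact mul_le_of_le_one_left (norm_nonneg z) ht.2.le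

lemma aestronglyMeasurable_comp_ofReal_mul {h : ℂ → ℂ} (hh : ContinuousOn h (Metric.ball 0 1))
    {μ : Measure ℝ} (hμ : μ (Ico (0 : ℝ) 1)ᶜ = 0) {z : ℂ} (hz : ‖z‖ < 1) :
    AEStronglyMeasurable (fun t : ℝ => h ((t : ℂ) * z)) μ := by
  rw [← Measure.restrict_eq_self_of_ae_mem (ae_mem_Ico hμ)]
  refine ContinuousOn.aestronglyMeasurable ?_ measurableSet_Ico
  refine hh.comp (by fun_prop) fun t ht => ?_
  simpa using (norm_ofReal_mul_le ht z).trans_lt hz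

/-- Differentiation under the integral: for `z` in a smaller disc all points `t z` stay in a compact
subset, where the derivative of the integrand is bounded, and constants are integrable since `μ` is
finite. -/
lemma HolDisc.cesaroOp {μ : Measure ℝ} [IsFiniteMeasure μ] (hμ : μ (Ico (0 : ℝ) 1)ᶜ = 0) {β : ℝ}
    {f : ℂ → ℂ} (hf : HolDisc f) : HolDisc (cesaroOp μ β f) := by
  set h : ℂ → ℂ := fun w => f w / (1 - w) ^ (β : ℂ) with hh
  have hhol : HolDisc h := hf.div_one_sub_cpow β
  have hd : DifferentiableOn ℂ (deriv h) (Metric.ball 0 1) :=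
    DifferentiableOn.deriv hhol Metric.isOpen_ball
  intro z₀ hz₀
  have hz₀' : ‖z₀‖ < 1 := by simpa using hz₀
  obtain ⟨R, hR0, hR1⟩ := exists_between hz₀'
  have hsub : Metric.closedBall (0 : ℂ) R ⊆ Metric.ball 0 1 := Metric.closedBall_subset_ball hR1
  obtain ⟨M, hM⟩ := (isCompact_closedBall (0 : ℂ) R).exists_bound_of_continuousOn
    (hd.continuousOn.mono hsub)
  obtain ⟨M', hM'⟩ := (isCompact_closedBall (0 : ℂ) R).exists_bound_of_continuousOn
    (hhol.continuousOn.mono hsub)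
  have hball : ∀ z ∈ Metric.ball (0 : ℂ) R, ∀ t ∈ Ico (0 : ℝ) 1,
      (t : ℂ) * z ∈ Metric.closedBall (0 : ℂ) R := fun z hz t ht => by
    simp only [Metric.mem_ball, dist_zero_right] at hz
    simpa using (norm_ofReal_mul_le ht z).trans hz.le
  have hnhds : Metric.ball (0 : ℂ) R ∈ nhds z₀ := Metric.isOpen_ball.mem_nhds (by simpa using hR0)
  have key := hasDerivAt_integral_of_dominated_loc_of_deriv_le (𝕜 := ℂ) (μ := μ)
    (F := fun z t => h ((t : ℂ) * z)) (F' := fun z t => deriv h ((t : ℂ) * z) * (t : ℂ))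
    (x₀ := z₀) (bound := fun _ => M) hnhds ?_ ?_ ?_ ?_ (integrable_const M) ?_
  · exact key.2.differentiableAt.differentiableWithinAt
  · filter_upwards [hnhds] with z hz
    refine aestronglyMeasurable_comp_ofReal_mul hhol.continuousOn hμ ?_
    exact (by simpa using hz : ‖z‖ < R).trans hR1
  · refine Integrable.of_bound
      (aestronglyMeasurable_comp_ofReal_mul hhol.continuousOn hμ hz₀') M' ?_
    filter_upwards [ae_mem_Ico hμ] with t ht
    exact hM' _ (hball z₀ (by simpa using hR0) t ht)
  · refine (aestronglyMeasurable_comp_ofReal_mul hd.continuousOn hμ hz₀').mul ?_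
    exact Complex.continuous_ofReal.aestronglyMeasurable
  · filter_upwards [ae_mem_Ico hμ] with t ht z hz
    rw [norm_mul, Complex.norm_real, Real.norm_of_nonneg ht.1]
    have h1 := hM _ (hball z hz t ht)
    exact (mul_le_of_le_one_right (norm_nonneg _) ht.2.le).trans h1
  · filter_upwards [ae_mem_Ico hμ] with t ht z hz
    have h1 : HasDerivAt h (deriv h ((t : ℂ) * z)) ((t : ℂ) * z) :=
      (DifferentiableOn.differentiableAt hhol
        (Metric.isOpen_ball.mem_nhds (hsub (hball z hz t ht)))).hasDerivAt
    have h2 : HasDerivAt (fun z : ℂ => (t : ℂ) * z) (t : ℂ) z := by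
      simpa using (hasDerivAt_id z).const_mul (t : ℂ)
    exact h1.comp z h2

lemma discWeight_anti {c x y : ℝ} (hc : 0 ≤ c) (hxy : x ≤ y) (hy : y < 1) :
    discWeight (-c) x ≤ discWeight (-c) y :=
  ENNReal.ofReal_le_ofReal
    (Real.rpow_le_rpow_of_nonpos (by linarith) (by linarith) (by linarith))

/-- The kernel is controlled by `|1 - t z| ≥ 1 - t |z|`. -/
lemma enorm_cesaroOp_le {μ : Measure ℝ} (hμ : μ (Ico (0 : ℝ) 1)ᶜ = 0) {β : ℝ} (hβ : 0 ≤ β)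
    (f : ℂ → ℂ) {z : ℂ} (hz : ‖z‖ < 1) :
    ‖cesaroOp μ β f z‖ₑ ≤ ∫⁻ t, ‖f ((t : ℂ) * z)‖ₑ * discWeight (-β) (t * ‖z‖) ∂μ := by
  refine (enorm_integral_le_lintegral_enorm _).trans (lintegral_mono_ae ?_)
  filter_upwards [ae_mem_Ico hμ] with t ht
  have hn : ‖(t : ℂ) * z‖ = t * ‖z‖ := by
    rw [norm_mul, Complex.norm_real, Real.norm_of_nonneg ht.1]
  have hw : ‖(t : ℂ) * z‖ < 1 := (norm_ofReal_mul_le ht z).trans_lt hz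
  have hpos : 0 < 1 - t * ‖z‖ := by linarith [hn ▸ hw]
  rw [div_eq_mul_inv, enorm_mul, ← Complex.cpow_neg, ← Complex.ofReal_neg]
  refine mul_le_mul_right ?_ _
  rw [← ofReal_norm, norm_cpow_ofReal (one_sub_ne_zero_of_norm_lt_one hw)]
  refine ENNReal.ofReal_le_ofReal (Real.rpow_le_rpow_of_nonpos hpos ?_ (by linarith))
  have := norm_sub_norm_le (1 : ℂ) ((t : ℂ) * z)
  rwa [hn, norm_one] at this

lemma ofReal_mul_circleMap_zero (t r θ : ℝ) :
    (t : ℂ) * circleMap 0 r θ = circleMap 0 (t * r) θ := by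
  simp [circleMap, mul_assoc]

/-- Minkowski's integral inequality, since `z ↦ t z` carries the circle of radius `r` to that of
radius `t r`. -/
lemma integralMean_cesaroOp_le {μ : Measure ℝ} [IsFiniteMeasure μ]
    (hμ : μ (Ico (0 : ℝ) 1)ᶜ = 0) {β : ℝ} (hβ : 0 ≤ β) {f : ℂ → ℂ} (hf : HolDisc f) {p : ℝ≥0∞}
    (hp : 1 ≤ p) (hp' : p < ∞) {r : ℝ} (hr0 : 0 ≤ r) (hr1 : r < 1) :
    integralMean p (cesaroOp μ β f) r
      ≤ ∫⁻ t, integralMean p f (t * r) * discWeight (-β) (t * r) ∂μ := by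
  have hp0 : p ≠ 0 := (zero_lt_one.trans_le hp).ne'
  have hP : 1 ≤ p.toReal := by
    simpa using ENNReal.toReal_mono hp'.ne hp
  have hP0 : 0 < p.toReal := by linarith
  classical
  -- `f` is arbitrary off the disc; cutting it to zero there gives the joint measurability that
  -- Minkowski's inequality needs.
  set g : ℂ → ℂ := (Metric.ball (0 : ℂ) 1).piecewise f 0 with hg
  have hgm : Measurable g :=
    hf.continuousOn.measurable_piecewise continuousOn_const Metric.isOpen_ball.measurableSet
  have hgf : ∀ t ∈ Ico (0 : ℝ) 1, ∀ θ : ℝ,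
      g (circleMap 0 (t * r) θ) = f (circleMap 0 (t * r) θ) := fun t ht θ => by
    refine piecewise_eq_of_mem _ _ _ ?_
    have h1 : t * r < 1 := by nlinarith [ht.1, ht.2]
    simpa [abs_of_nonneg (mul_nonneg ht.1 hr0)] using h1
  set F : ℝ → ℝ → ℝ≥0∞ := fun θ t => ‖g (circleMap 0 (t * r) θ)‖ₑ * discWeight (-β) (t * r) with hF
  have hFm : Measurable (Function.uncurry F) := by
    refine Measurable.mul (hgm.comp ?_).enorm ((measurable_discWeight _).comp (by fun_prop))
    simp only [circleMap]
    fun_prop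
  obtain ⟨M, hM⟩ := (isCompact_closedBall (0 : ℂ) r).exists_bound_of_continuousOn
    (hf.continuousOn.mono (Metric.closedBall_subset_ball hr1))
  have hnorm : ∀ θ, ‖circleMap 0 r θ‖ = r := fun θ => by simp [abs_of_nonneg hr0]
  have hGle : ∀ θ, ∫⁻ t, F θ t ∂μ ≤ ENNReal.ofReal M * discWeight (-β) r * μ univ := fun θ => by
    rw [← lintegral_const]
    refine lintegral_mono_ae ?_
    filter_upwards [ae_mem_Ico hμ] with t ht
    have h1 : t * r ≤ r := mul_le_of_le_one_left hr0 ht.2.le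
    simp only [hF, hgf t ht θ]
    refine mul_le_mul' ?_ (discWeight_anti hβ h1 hr1)
    rw [← ofReal_norm]
    refine ENNReal.ofReal_le_ofReal (hM _ ?_)
    simpa [abs_of_nonneg (mul_nonneg ht.1 hr0)] using h1
  have hfin : ∫⁻ θ, (∫⁻ t, F θ t ∂μ) ^ p.toReal ∂arcMeasure ≠ ∞ := by
    refine ((lintegral_mono fun θ => ENNReal.rpow_le_rpow (hGle θ) hP0.le).trans_lt ?_).ne
    rw [lintegral_const, measure_univ (μ := arcMeasure), mul_one]
    refine ENNReal.rpow_lt_top_of_nonneg hP0.le ?_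
    exact ENNReal.mul_ne_top (ENNReal.mul_ne_top ENNReal.ofReal_ne_top (discWeight_ne_top _ _))
      (measure_ne_top _ _)
  rw [integralMean, eLpNorm_eq_lintegral_rpow_enorm_toReal hp0 hp'.ne]
  calc (∫⁻ θ, ‖cesaroOp μ β f (circleMap 0 r θ)‖ₑ ^ p.toReal ∂arcMeasure) ^ (1 / p.toReal)
      ≤ (∫⁻ θ, (∫⁻ t, F θ t ∂μ) ^ p.toReal ∂arcMeasure) ^ (1 / p.toReal) := by
        refine ENNReal.rpow_le_rpow (lintegral_mono fun θ => ?_) (by positivity)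
        refine ENNReal.rpow_le_rpow ?_ hP0.le
        refine (enorm_cesaroOp_le hμ hβ f (by rw [hnorm]; exact hr1)).trans_eq ?_
        refine lintegral_congr_ae ?_
        filter_upwards [ae_mem_Ico hμ] with t ht
        simp only [hF, hnorm, hgf t ht, ofReal_mul_circleMap_zero]
    _ ≤ ∫⁻ t, (∫⁻ θ, F θ t ^ p.toReal ∂arcMeasure) ^ (1 / p.toReal) ∂μ :=
        lintegral_lintegral_rpow_le hFm hP hfin
    _ = _ := by
        refine lintegral_congr_ae ?_
        filter_upwards [ae_mem_Ico hμ] with t ht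
        simp only [hF, hgf t ht, ENNReal.mul_rpow_of_nonneg _ _ hP0.le]
        have h1 : t * r < 1 := by nlinarith [ht.1, ht.2]
        rw [lintegral_mul_const' _ _ (ENNReal.rpow_ne_top_of_nonneg hP0.le (discWeight_ne_top _ _)),
          ENNReal.mul_rpow_of_nonneg _ _ (by positivity), ← ENNReal.rpow_mul (discWeight _ _),
          mul_one_div_cancel hP0.ne', ENNReal.rpow_one, integralMean,
          eLpNorm_eq_lintegral_rpow_enorm_toReal hp0 hp'.ne]

/-! ### Sufficiency of the Carleson condition -/

section Carleson

variable {μ : Measure ℝ} [IsFiniteMeasure μ] {β γ₁ γ₂ : ℝ}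

/-- Growth of `f` and kernel combine to `(1 - t |z|)^(-(β + γ₁))`, and with `b = β + γ₁` the
Carleson estimate has exponent exactly `s - b = -γ₂`. -/
theorem isBoundedBetween_korenblumNorm (hμ : μ (Ico (0 : ℝ) 1)ᶜ = 0) (hβ : 0 < β)
    (hγ₂ : 0 < γ₂) (hlt : γ₂ < γ₁ + β) (hc : IsCarleson μ (β + γ₁ - γ₂)) :
    IsBoundedBetween (cesaroOp μ β) (korenblumNorm γ₁) (korenblumNorm γ₂) := by
  obtain ⟨C, hC⟩ := hc.exists_lintegral_le hμ (b := β + γ₁) (by linarith) (by linarith)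
  refine ⟨C, fun f hf _ => ⟨hf.cesaroOp hμ, iSup₂_le fun z hz => ?_⟩⟩
  have hz1 : ‖z‖ < 1 := by simpa using hz
  set N := korenblumNorm γ₁ f
  have hN : ∀ w : ℂ, ‖w‖ < 1 → ‖f w‖ₑ ≤ N * discWeight (-γ₁) ‖w‖ := fun w hw => by
    calc ‖f w‖ₑ = (discWeight γ₁ ‖w‖ * ‖f w‖ₑ) * discWeight (-γ₁) ‖w‖ := by
          rw [mul_right_comm, discWeight_mul_neg hw, one_mul]
      _ ≤ N * discWeight (-γ₁) ‖w‖ := by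
          refine mul_le_mul_left ?_ _
          exact le_iSup₂ (f := fun z (_ : z ∈ Metric.ball (0 : ℂ) 1) =>
            ENNReal.ofReal ((1 - ‖z‖) ^ γ₁) * ‖f z‖ₑ) w (by simpa using hw)
  calc discWeight γ₂ ‖z‖ * ‖cesaroOp μ β f z‖ₑ
      ≤ discWeight γ₂ ‖z‖ * ∫⁻ t, ‖f ((t : ℂ) * z)‖ₑ * discWeight (-β) (t * ‖z‖) ∂μ :=
        mul_le_mul_right (enorm_cesaroOp_le hμ hβ.le f hz1) _
    _ ≤ discWeight γ₂ ‖z‖ * ∫⁻ t, N * discWeight (-(β + γ₁)) (t * ‖z‖) ∂μ := by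
        refine mul_le_mul_right (lintegral_mono_ae ?_) _
        filter_upwards [ae_mem_Ico hμ] with t ht
        have h1 : ‖(t : ℂ) * z‖ = t * ‖z‖ := by
          rw [norm_mul, Complex.norm_real, Real.norm_of_nonneg ht.1]
        have h2 := (norm_ofReal_mul_le ht z).trans_lt hz1
        have h3 := hN _ h2
        rw [h1] at h2 h3
        refine (mul_le_mul_left h3 _).trans_eq ?_
        rw [mul_assoc, discWeight_mul h2]
        congr 2; ring
    _ ≤ discWeight γ₂ ‖z‖ * (N * (C * discWeight (-γ₂) ‖z‖)) := by
        rw [lintegral_const_mul _ (by fun_prop)]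
        refine mul_le_mul_right (mul_le_mul_right ?_ _) _
        refine (hC ‖z‖ ⟨norm_nonneg z, hz1⟩).trans_eq ?_
        congr 2; ring
    _ = C * N * (discWeight γ₂ ‖z‖ * discWeight (-γ₂) ‖z‖) := by ring
    _ = C * N := by rw [discWeight_mul_neg hz1, mul_one]

lemma discWeight_half (c : ℝ) {x : ℝ} (hx : x < 1) :
    discWeight (-c) ((1 + x) / 2) = ENNReal.ofReal (2 ^ c) * discWeight (-c) x := by
  rw [discWeight, discWeight, ← ENNReal.ofReal_mul (by positivity),
    show 1 - (1 + x) / 2 = (1 - x) / 2 by ring, Real.div_rpow (by linarith) (by norm_num),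
    Real.rpow_neg (x := 2) (by norm_num), div_inv_eq_mul, mul_comm]

lemma integralMean_le_mixedNorm_top {p : ℝ≥0∞} {γ : ℝ} (f : ℂ → ℂ) {r : ℝ}
    (hr : r ∈ Ioo (0 : ℝ) 1) :
    integralMean p f r ≤ mixedNorm p ∞ γ f * discWeight (-γ) r := by
  calc integralMean p f r = (discWeight γ r * integralMean p f r) * discWeight (-γ) r := by
        rw [mul_right_comm, discWeight_mul_neg hr.2, one_mul]
    _ ≤ mixedNorm p ∞ γ f * discWeight (-γ) r := by
        refine mul_le_mul_left ?_ _
        rw [mixedNorm, if_pos rfl]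
        exact le_iSup₂ (f := fun r (_ : r ∈ Ioo (0 : ℝ) 1) =>
          ENNReal.ofReal ((1 - r) ^ γ) * integralMean p f r) r hr

theorem isBoundedBetween_mixedNorm_top (hμ : μ (Ico (0 : ℝ) 1)ᶜ = 0) (hβ : 0 < β)
    (hγ₂ : 0 < γ₂) (hlt : γ₂ < γ₁ + β) (hc : IsCarleson μ (β + γ₁ - γ₂)) {p : ℝ≥0∞}
    (hp : 1 ≤ p) (hp' : p < ∞) :
    IsBoundedBetween (cesaroOp μ β) (mixedNorm p ∞ γ₁) (mixedNorm p ∞ γ₂) := by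
  obtain ⟨C, hC⟩ := hc.exists_lintegral_le hμ (b := β + γ₁) (by linarith) (by linarith)
  refine ⟨(2 ^ γ₁ : ℝ).toNNReal * C, fun f hf _ => ⟨hf.cesaroOp hμ, ?_⟩⟩
  conv_lhs => rw [mixedNorm, if_pos rfl]
  refine iSup₂_le fun r hr => ?_
  set N := mixedNorm p ∞ γ₁ f
  -- The norm only controls radii in `(0, 1)`, while `t r` can be `0`. Passing to the midpoint `(1 +
  -- x) / 2` covers this case at the price of `2 ^ γ₁`.
  have hN : ∀ x ∈ Ico (0 : ℝ) 1,
      integralMean p f x ≤ N * (ENNReal.ofReal (2 ^ γ₁) * discWeight (-γ₁) x) := fun x hx => by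
    rw [← discWeight_half _ hx.2]
    have hx1 := hx.2
    have hx0 := hx.1
    exact (hf.integralMean_mono hp hp' hx0 (by linarith) (by linarith)).trans
      (integralMean_le_mixedNorm_top f (r := (1 + x) / 2) ⟨by linarith, by linarith⟩)
  calc discWeight γ₂ r * integralMean p (cesaroOp μ β f) r
      ≤ discWeight γ₂ r * ∫⁻ t, integralMean p f (t * r) * discWeight (-β) (t * r) ∂μ :=
        mul_le_mul_right (integralMean_cesaroOp_le hμ hβ.le hf hp hp' hr.1.le hr.2) _
    _ ≤ discWeight γ₂ r *
          ∫⁻ t, (N * ENNReal.ofReal (2 ^ γ₁)) * discWeight (-(β + γ₁)) (t * r) ∂μ := by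
        refine mul_le_mul_right (lintegral_mono_ae ?_) _
        filter_upwards [ae_mem_Ico hμ] with t ht
        have h2 : t * r < 1 := by nlinarith [ht.1, ht.2, hr.1, hr.2]
        refine (mul_le_mul_left (hN _ ⟨mul_nonneg ht.1 hr.1.le, h2⟩) _).trans_eq ?_
        rw [← mul_assoc, mul_assoc, discWeight_mul h2]
        congr 2; ring
    _ ≤ discWeight γ₂ r * ((N * ENNReal.ofReal (2 ^ γ₁)) * (C * discWeight (-γ₂) r)) := by
        rw [lintegral_const_mul _ (by fun_prop)]
        refine mul_le_mul_right (mul_le_mul_right ?_ _) _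
        refine (hC r ⟨hr.1.le, hr.2⟩).trans_eq ?_
        congr 2; ring
    _ = ENNReal.ofReal (2 ^ γ₁) * C * N * (discWeight γ₂ r * discWeight (-γ₂) r) := by ring
    _ = _ := by rw [discWeight_mul_neg hr.2, mul_one, ENNReal.coe_mul]; rfl

/-- The integral mean as a monotone function on the whole line. -/
noncomputable def extendedMean (p : ℝ≥0∞) (f : ℂ → ℂ) (r : ℝ) : ℝ≥0∞ :=
  if r < 0 then 0 else if r < 1 then integralMean p f r else ∞

lemma extendedMean_eq {p : ℝ≥0∞} {f : ℂ → ℂ} {r : ℝ} (hr : r ∈ Ico (0 : ℝ) 1) :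
    extendedMean p f r = integralMean p f r := by
  rw [extendedMean, if_neg hr.1.not_gt, if_pos hr.2]

/-- The Hardy type inequality is stated for functions monotone on all of `ℝ`; the values `0` on the
left and `∞` on the right serve only this. -/
lemma HolDisc.monotone_extendedMean {p : ℝ≥0∞} (hp : 1 ≤ p) (hp' : p < ∞) {f : ℂ → ℂ}
    (hf : HolDisc f) : Monotone (extendedMean p f) := by
  intro x y hxy
  by_cases hx : x < 0
  · simp [extendedMean, hx]
  by_cases hy : y < 1
  · rw [extendedMean_eq ⟨not_lt.1 hx, hxy.trans_lt hy⟩,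
      extendedMean_eq ⟨(not_lt.1 hx).trans hxy, hy⟩]
    exact hf.integralMean_mono hp hp' (not_lt.1 hx) hxy hy
  · have hy0 : ¬ y < 0 := by linarith
    simp [extendedMean, hy, hy0]

lemma mixedNorm_of_ne_top {p q : ℝ≥0∞} (hq : q ≠ ∞) (γ : ℝ) (f : ℂ → ℂ) :
    mixedNorm p q γ f = (∫⁻ r in Ioo (0 : ℝ) 1,
      discWeight (γ * q.toReal - 1) r * integralMean p f r ^ q.toReal) ^ (1 / q.toReal) := by
  rw [mixedNorm, if_neg hq]; rfl

theorem isBoundedBetween_mixedNorm (hμ : μ (Ico (0 : ℝ) 1)ᶜ = 0) (hβ : 0 < β) (hγ₁ : 0 < γ₁)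
    (hγ₂ : 0 < γ₂) (hlt : γ₂ < γ₁ + β) (hc : IsCarleson μ (β + γ₁ - γ₂)) {p q : ℝ≥0∞}
    (hp : 1 ≤ p) (hp' : p < ∞) (hq : 0 < q) (hq' : q < ∞) :
    IsBoundedBetween (cesaroOp μ β) (mixedNorm p q γ₁) (mixedNorm p q γ₂) := by
  have hQ : 0 < q.toReal := ENNReal.toReal_pos hq.ne' hq'.ne
  set Q := q.toReal
  -- The Hardy type inequality needs `0 < a < γ₁`, and `a > γ₁ - γ₂` is the condition `s < β + a` of
  -- the Carleson estimate. Both can hold because `γ₁` and `γ₂` are positive.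
  obtain ⟨a, ha0, ha1, ha2⟩ : ∃ a, 0 < a ∧ a < γ₁ ∧ γ₁ - γ₂ < a := by
    have h : max 0 (γ₁ - γ₂) < γ₁ := max_lt hγ₁ (by linarith)
    obtain ⟨a, h1, h2⟩ := exists_between h
    exact ⟨a, (le_max_left _ _).trans_lt h1, h2, (le_max_right _ _).trans_lt h1⟩
  obtain ⟨C, hC⟩ := hc.exists_lintegral_le hμ (b := β + a) (by linarith) (by linarith)
  obtain ⟨K, hK⟩ := exists_lintegral_iSup_rpow_le ha0 ha1 hQ
  refine ⟨(C ^ Q * K) ^ (1 / Q), fun f hf _ => ⟨hf.cesaroOp hμ, ?_⟩⟩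
  rw [mixedNorm_of_ne_top hq'.ne, mixedNorm_of_ne_top hq'.ne,
    ENNReal.coe_rpow_of_nonneg _ (by positivity), ← ENNReal.mul_rpow_of_nonneg _ _ (by positivity),
    ENNReal.coe_mul, ENNReal.coe_rpow_of_nonneg _ hQ.le]
  refine ENNReal.rpow_le_rpow ?_ (by positivity)
  set φ := extendedMean p f
  -- Only the part `(1 - x)^(-a)` of the growth is left to the `μ`-integral. The output exponent `γ₁
  -- - γ₂ - a` turns the weight of index `γ₂` into that of index `γ₁ - a`, as in the Hardy type
  -- inequality.
  have hmean : ∀ r ∈ Ioo (0 : ℝ) 1, integralMean p (cesaroOp μ β f) r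
      ≤ (⨆ ρ ∈ Icc (0 : ℝ) r, φ ρ * discWeight a ρ) * (C * discWeight (γ₁ - γ₂ - a) r) := by
    intro r hr
    refine (integralMean_cesaroOp_le hμ hβ.le hf hp hp' hr.1.le hr.2).trans ?_
    calc ∫⁻ t, integralMean p f (t * r) * discWeight (-β) (t * r) ∂μ
        ≤ ∫⁻ t, (⨆ ρ ∈ Icc (0 : ℝ) r, φ ρ * discWeight a ρ) *
            discWeight (-(β + a)) (t * r) ∂μ := by
          refine lintegral_mono_ae ?_
          filter_upwards [ae_mem_Ico hμ] with t ht
          have h0 : 0 ≤ t * r := mul_nonneg ht.1 hr.1.le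
          have h1 : t * r ≤ r := mul_le_of_le_one_left hr.1.le ht.2.le
          have h2 : t * r < 1 := h1.trans_lt hr.2
          calc integralMean p f (t * r) * discWeight (-β) (t * r)
              = (φ (t * r) * discWeight a (t * r)) * discWeight (-(β + a)) (t * r) := by
                rw [mul_assoc, discWeight_mul h2, show φ (t * r) = _ from extendedMean_eq ⟨h0, h2⟩]
                congr 2; ring
            _ ≤ _ := by
                refine mul_le_mul_left ?_ _
                exact le_iSup₂ (f := fun ρ (_ : ρ ∈ Icc (0 : ℝ) r) => φ ρ * discWeight a ρ)
                  (t * r) ⟨h0, h1⟩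
      _ ≤ _ := by
          rw [lintegral_const_mul _ (by fun_prop)]
          refine mul_le_mul_right ?_ _
          refine (hC r ⟨hr.1.le, hr.2⟩).trans_eq ?_
          congr 2; ring
  calc ∫⁻ r in Ioo (0 : ℝ) 1,
        discWeight (γ₂ * Q - 1) r * integralMean p (cesaroOp μ β f) r ^ Q
      ≤ ∫⁻ r in Ioo (0 : ℝ) 1, (C : ℝ≥0∞) ^ Q * (discWeight ((γ₁ - a) * Q - 1) r *
          (⨆ ρ ∈ Icc (0 : ℝ) r, φ ρ * discWeight a ρ) ^ Q) := by
        refine setLIntegral_mono' measurableSet_Ioo fun r hr => ?_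
        refine (mul_le_mul_right (ENNReal.rpow_le_rpow (hmean r hr) hQ.le) _).trans_eq ?_
        rw [ENNReal.mul_rpow_of_nonneg _ _ hQ.le, ENNReal.mul_rpow_of_nonneg _ _ hQ.le,
          discWeight_rpow hr.2 _ hQ.le, show (γ₁ - a) * Q - 1
            = (γ₂ * Q - 1) + (γ₁ - γ₂ - a) * Q by ring, ← discWeight_mul hr.2]
        ring
    _ = (C : ℝ≥0∞) ^ Q * ∫⁻ r in Ioo (0 : ℝ) 1, (discWeight ((γ₁ - a) * Q - 1) r *
          (⨆ ρ ∈ Icc (0 : ℝ) r, φ ρ * discWeight a ρ) ^ Q) :=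
        lintegral_const_mul' _ _ (ENNReal.rpow_ne_top_of_nonneg hQ.le ENNReal.coe_ne_top)
    _ ≤ (C : ℝ≥0∞) ^ Q * (K * ∫⁻ r in Ioo (0 : ℝ) 1, discWeight (γ₁ * Q - 1) r * φ r ^ Q) :=
        mul_le_mul_right (hK φ (hf.monotone_extendedMean hp hp')) _
    _ = _ := by
        rw [← mul_assoc]
        congr 1
        refine setLIntegral_congr_fun measurableSet_Ioo fun r hr => ?_
        simp only [φ, Q, extendedMean_eq (Ioo_subset_Ico_self hr)]

end Carleson

/-! ### Comparison of norms -/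

lemma mixedNorm_top_top_le_korenblumNorm (γ : ℝ) (f : ℂ → ℂ) :
    mixedNorm ∞ ∞ γ f ≤ korenblumNorm γ f := by
  rw [mixedNorm, if_pos rfl]
  refine iSup₂_le fun r hr => ?_
  have hmean : integralMean ∞ f r ≤ korenblumNorm γ f * discWeight (-γ) r := by
    rw [integralMean, eLpNorm_exponent_top]
    refine eLpNormEssSup_le_of_ae_enorm_bound (.of_forall fun θ => ?_)
    have hn : ‖circleMap 0 r θ‖ = r := by simp [abs_of_pos hr.1]
    calc ‖f (circleMap 0 r θ)‖ₑ
        = (discWeight γ r * ‖f (circleMap 0 r θ)‖ₑ) * discWeight (-γ) r := by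
          rw [mul_right_comm, discWeight_mul_neg hr.2, one_mul]
      _ ≤ _ := by
          refine mul_le_mul_left ?_ _
          have h := le_iSup₂ (f := fun z (_ : z ∈ Metric.ball (0 : ℂ) 1) =>
            ENNReal.ofReal ((1 - ‖z‖) ^ γ) * ‖f z‖ₑ) (circleMap 0 r θ)
            (by simpa [hn] using hr.2)
          simp only [hn] at h
          exact h
  refine (mul_le_mul_right hmean (discWeight γ r)).trans_eq ?_
  rw [mul_left_comm, discWeight_mul_neg hr.2, mul_one]

/-- The centre lies on no circle of positive radius, and the mean is an essential supremum, so the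
value at `z` is compared with the circle of radius `(1 + |z|) / 2` by the maximum principle. -/
lemma HolDisc.korenblumNorm_le_mixedNorm_top_top {f : ℂ → ℂ} (hf : HolDisc f) (γ : ℝ) :
    korenblumNorm γ f ≤ ENNReal.ofReal (2 ^ γ) * mixedNorm ∞ ∞ γ f := by
  refine iSup₂_le fun z hz => ?_
  have hz1 : ‖z‖ < 1 := by simpa using hz
  have hz0 := norm_nonneg z
  have h1 : ‖f z‖ₑ ≤ integralMean ∞ f ((1 + ‖z‖) / 2) := by
    simpa using hf.enorm_le_integralMean (w := z) (R := (1 + ‖z‖) / 2) (by linarith)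
      (by linarith) (p := ∞) le_top
  have h2 := h1.trans (integralMean_le_mixedNorm_top (γ := γ) f ⟨by linarith, by linarith⟩)
  rw [discWeight_half γ hz1] at h2
  refine (mul_le_mul_right h2 (discWeight γ ‖z‖)).trans_eq ?_
  calc discWeight γ ‖z‖ * (mixedNorm ∞ ∞ γ f * (ENNReal.ofReal (2 ^ γ) * discWeight (-γ) ‖z‖))
      = ENNReal.ofReal (2 ^ γ) * mixedNorm ∞ ∞ γ f *
          (discWeight γ ‖z‖ * discWeight (-γ) ‖z‖) := by ring
    _ = _ := by rw [discWeight_mul_neg hz1, mul_one]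

lemma isBoundedBetween_mixedNorm_top_top_iff {T : (ℂ → ℂ) → (ℂ → ℂ)} {γ₁ γ₂ : ℝ} :
    IsBoundedBetween T (mixedNorm ∞ ∞ γ₁) (mixedNorm ∞ ∞ γ₂)
      ↔ IsBoundedBetween T (korenblumNorm γ₁) (korenblumNorm γ₂) := by
  constructor
  · rintro ⟨C, hC⟩
    refine ⟨(2 ^ γ₂ : ℝ).toNNReal * C, fun f hf hfin => ?_⟩
    have hle := mixedNorm_top_top_le_korenblumNorm γ₁ f
    obtain ⟨h1, h2⟩ := hC f hf (hle.trans_lt hfin)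
    refine ⟨h1, (h1.korenblumNorm_le_mixedNorm_top_top γ₂).trans ?_⟩
    rw [ENNReal.coe_mul, mul_assoc]
    exact mul_le_mul_right (h2.trans (mul_le_mul_right hle _)) _
  · rintro ⟨C, hC⟩
    refine ⟨C * (2 ^ γ₁ : ℝ).toNNReal, fun f hf hfin => ?_⟩
    have hle := hf.korenblumNorm_le_mixedNorm_top_top γ₁
    obtain ⟨h1, h2⟩ := hC f hf (hle.trans_lt (ENNReal.mul_lt_top ENNReal.ofReal_lt_top hfin))
    refine ⟨h1, (mixedNorm_top_top_le_korenblumNorm γ₂ _).trans (h2.trans ?_)⟩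
    rw [ENNReal.coe_mul, mul_assoc]
    exact mul_le_mul_right hle _

/-- Pointwise growth of functions in `H(p, q, γ)` along the positive radius. -/
theorem exists_enorm_le_mixedNorm {p q : ℝ≥0∞} (hp : 1 ≤ p) (hp' : p < ∞) (hq : 0 < q)
    (hq' : q < ∞) {γ : ℝ} (hγ : 0 < γ) :
    ∃ C : ℝ≥0, ∀ f : ℂ → ℂ, HolDisc f → ∀ ρ ∈ Ico (0 : ℝ) 1,
      ‖f ρ‖ₑ ≤ C * mixedNorm p q γ f * discWeight (-(γ + 1 / p.toReal)) ρ := by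
  have hQ : 0 < q.toReal := ENNReal.toReal_pos hq.ne' hq'.ne
  have hP : 0 < p.toReal := ENNReal.toReal_pos (zero_lt_one.trans_le hp).ne' hp'.ne
  set Q := q.toReal
  set P := p.toReal
  have hγQ : 0 < γ * Q := mul_pos hγ hQ
  -- With `R = (1 + ρ) / 2`: the Harnack constant is at most `4 / (1 - ρ)`, the weight of exponent
  -- `γ Q - 1` has mass `(1 - R)^(γ Q) / (γ Q)` on `(R, 1)`, and `1 - R = (1 - ρ) / 2`.
  refine ⟨(4 ^ (1 / P) * ((γ * Q) ^ (1 / Q) * 2 ^ γ) : ℝ).toNNReal, fun f hf ρ hρ => ?_⟩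
  obtain ⟨h0, h1⟩ := hρ
  set R := (1 + ρ) / 2 with hR
  have hR1 : R < 1 := by linarith
  have hR0 : 0 < R := by linarith
  have hnorm : ‖(ρ : ℂ)‖ = ρ := by rw [Complex.norm_real, Real.norm_of_nonneg h0]
  have hpt : ‖f ρ‖ₑ ≤ ENNReal.ofReal (4 ^ (1 / P)) * discWeight (-(1 / P)) ρ
      * integralMean p f R := by
    refine (hf.enorm_le_integralMean (w := (ρ : ℂ)) (R := R) (by rw [hnorm]; linarith) hR1
      hp).trans ?_
    refine mul_le_mul_left ?_ _
    have hd : (0 : ℝ) < 1 - ρ := by linarith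
    have h1P : (1 / p).toReal = 1 / P := by simp [P]
    rw [hnorm, h1P, ENNReal.ofReal_rpow_of_nonneg (div_nonneg (by linarith) (by linarith))
      (by positivity), discWeight, ← ENNReal.ofReal_mul (by positivity)]
    refine ENNReal.ofReal_le_ofReal ?_
    rw [Real.rpow_neg hd.le, ← div_eq_mul_inv, ← Real.div_rpow (by norm_num) hd.le]
    refine Real.rpow_le_rpow (div_nonneg (by linarith) (by linarith)) ?_ (by positivity)
    rw [div_le_div_iff₀ (by linarith) hd]
    nlinarith
  have hmean : integralMean p f R
      ≤ ENNReal.ofReal ((γ * Q) ^ (1 / Q)) * mixedNorm p q γ f * discWeight (-γ) R := by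
    -- Since the means increase, the value at `R` is dominated by the part of the norm integral over
    -- `(R, 1)`.
    have hint : discWeight (γ * Q) R * integralMean p f R ^ Q
        ≤ ENNReal.ofReal (γ * Q) * mixedNorm p q γ f ^ Q := by
      rw [mixedNorm_of_ne_top hq'.ne, ← ENNReal.rpow_mul, one_div_mul_cancel hQ.ne',
        ENNReal.rpow_one]
      calc discWeight (γ * Q) R * integralMean p f R ^ Q
          = ENNReal.ofReal (γ * Q) *
              ∫⁻ r in Ioc R 1, discWeight (γ * Q - 1) r * integralMean p f R ^ Q := by
            rw [lintegral_mul_const _ (measurable_discWeight _),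
              setLIntegral_discWeight hγQ hR1.le le_rfl, ← mul_assoc,
              ← ENNReal.ofReal_mul hγQ.le, sub_self, Real.zero_rpow hγQ.ne', sub_zero,
              mul_div_cancel₀ _ hγQ.ne']
            rfl
        _ ≤ _ := by
            refine mul_le_mul_right ?_ _
            rw [← restrict_Ioo_eq_restrict_Ioc]
            refine le_trans (setLIntegral_mono' measurableSet_Ioo fun r hr => ?_)
              (lintegral_mono_set (Ioo_subset_Ioo_left hR0.le))
            refine mul_le_mul_right (ENNReal.rpow_le_rpow ?_ hQ.le) _
            exact hf.integralMean_mono hp hp' hR0.le hr.1.le hr.2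
    have hroot := ENNReal.rpow_le_rpow hint (one_div_nonneg.2 hQ.le)
    rw [ENNReal.mul_rpow_of_nonneg _ _ (by positivity),
      ENNReal.mul_rpow_of_nonneg _ _ (by positivity), discWeight_rpow hR1 _ (by positivity),
      ← ENNReal.rpow_mul, ← ENNReal.rpow_mul, mul_one_div_cancel hQ.ne', ENNReal.rpow_one,
      ENNReal.rpow_one, mul_assoc γ, mul_one_div_cancel hQ.ne', mul_one,
      ENNReal.ofReal_rpow_of_nonneg hγQ.le (by positivity)] at hroot
    refine le_trans (le_of_eq ?_) (mul_le_mul_left hroot (discWeight (-γ) R))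
    rw [mul_right_comm, discWeight_mul_neg hR1, one_mul]
  refine (hpt.trans (mul_le_mul_right hmean _)).trans_eq ?_
  rw [hR, discWeight_half γ h1, show -(γ + 1 / P) = -(1 / P) + -γ by ring, ← discWeight_mul h1]
  change _ = ENNReal.ofReal _ * _ * _
  rw [ENNReal.ofReal_mul (by positivity), ENNReal.ofReal_mul (by positivity)]
  ring

/-! ### Test functions -/

/-- The test function `(1 - ρ z) ^ (-m)`. -/
noncomputable def testFun (ρ m : ℝ) (z : ℂ) : ℂ := (1 - (ρ : ℂ) * z) ^ (-(m : ℂ))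

lemma holDisc_testFun {ρ : ℝ} (hρ : ρ ∈ Ico (0 : ℝ) 1) (m : ℝ) : HolDisc (testFun ρ m) := by
  refine DifferentiableOn.cpow (by fun_prop) (by fun_prop) fun z hz => ?_
  exact one_sub_mem_slitPlane ((norm_ofReal_mul_le hρ z).trans_lt (by simpa using hz))

lemma norm_testFun {ρ : ℝ} (hρ : ρ ∈ Ico (0 : ℝ) 1) (m : ℝ) {z : ℂ} (hz : ‖z‖ < 1) :
    ‖testFun ρ m z‖ = ‖1 - (ρ : ℂ) * z‖ ^ (-m) := by
  rw [testFun, ← Complex.ofReal_neg, norm_cpow_ofReal]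
  exact one_sub_ne_zero_of_norm_lt_one ((norm_ofReal_mul_le hρ z).trans_lt hz)

lemma korenblumNorm_testFun_le {ρ γ : ℝ} (hρ : ρ ∈ Ico (0 : ℝ) 1) (hγ : 0 ≤ γ) :
    korenblumNorm γ (testFun ρ γ) ≤ 1 := by
  refine iSup₂_le fun z hz => ?_
  have hz1 : ‖z‖ < 1 := by simpa using hz
  rw [← discWeight_mul_neg hz1 γ]
  refine mul_le_mul_right ?_ (discWeight γ ‖z‖)
  rw [← ofReal_norm, norm_testFun hρ γ hz1]
  refine ENNReal.ofReal_le_ofReal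
    (Real.rpow_le_rpow_of_nonpos (by linarith) ?_ (by linarith))
  have h1 := norm_sub_norm_le (1 : ℂ) ((ρ : ℂ) * z)
  rw [norm_one] at h1
  linarith [norm_ofReal_mul_le hρ z]

/-- The power `m p ≥ 2` is split: two factors of `|1 - x e^{iθ}|⁻¹` form the Poisson kernel divided
by `1 - x²`, and the others are bounded by `(1 - x)⁻¹`. The unit mass of the kernel then replaces a
computation of the integral. -/
lemma integralMean_testFun_le {ρ m r : ℝ} (hρ : ρ ∈ Ico (0 : ℝ) 1) (hm : 2 ≤ m) {p : ℝ≥0∞}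
    (hp : 1 ≤ p) (hp' : p < ∞) (hr : r ∈ Ico (0 : ℝ) 1) :
    integralMean p (testFun ρ m) r ≤ discWeight (1 / p.toReal - m) (r * ρ) := by
  have hP : 1 ≤ p.toReal := by simpa using ENNReal.toReal_mono hp'.ne hp
  have hP0 : 0 < p.toReal := by linarith
  set P := p.toReal
  have hmP : 2 ≤ m * P := by nlinarith
  set x := r * ρ with hx
  have hx0 : 0 ≤ x := mul_nonneg hr.1 hρ.1
  have hx1 : x < 1 := by nlinarith [hr.1, hr.2, hρ.1, hρ.2]
  have hd : 0 < 1 - x := by linarith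
  have hxn : ‖(x : ℂ)‖ = x := by rw [Complex.norm_real, Real.norm_of_nonneg hx0]
  rw [← ENNReal.rpow_le_rpow_iff hP0, integralMean_rpow hp hp', discWeight_rpow hx1 _ hP0.le]
  calc ∫⁻ θ, ‖testFun ρ m (circleMap 0 r θ)‖ₑ ^ P ∂arcMeasure
      ≤ ∫⁻ θ, discWeight ((1 / P - m) * P) x * poissonDensity 1 x θ ∂arcMeasure := by
        refine lintegral_mono fun θ => ?_
        have hz : ‖circleMap 0 r θ‖ < 1 := by simpa [abs_of_nonneg hr.1] using hr.2
        have hD : ‖1 - (ρ : ℂ) * circleMap 0 r θ‖ = ‖circleMap 0 1 θ - (x : ℂ)‖ := by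
          have h := norm_circleMap_sub_circleMap_comm x 1 θ 0
          rw [ofReal_mul_circleMap_zero, mul_comm ρ r]
          simpa [circleMap, hx] using h.symm
        obtain ⟨h1, h2⟩ := norm_circleMap_sub_pos (R := 1) (w := (x : ℂ)) (by rwa [hxn]) θ
        rw [hxn] at h1
        rw [← ofReal_norm, norm_testFun hρ m hz, hD, poissonDensity, poissonKernel_circleMap, hxn,
          discWeight, ← ENNReal.ofReal_mul (by positivity),
          ENNReal.ofReal_rpow_of_nonneg (by positivity) hP0.le]
        refine ENNReal.ofReal_le_ofReal ?_
        set D := ‖circleMap 0 1 θ - (x : ℂ)‖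
        rw [← Real.rpow_mul h2.le, show -m * P = -(m * P - 2) + (-2 : ℝ) by ring,
          Real.rpow_add h2, show (1 / P - m) * P = -(m * P - 2) + (-1 : ℝ) by
            field_simp; ring, Real.rpow_add hd, Real.rpow_neg_one,
          Real.rpow_neg h2.le 2, Real.rpow_two, mul_assoc]
        have h3 : D ^ (-(m * P - 2)) ≤ (1 - x) ^ (-(m * P - 2)) :=
          Real.rpow_le_rpow_of_nonpos hd h1 (by linarith)
        refine mul_le_mul h3 ?_ (by positivity) (by positivity)
        rw [show (1 : ℝ) ^ 2 - x ^ 2 = (1 - x) * (1 + x) by ring, mul_div_assoc,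
          inv_mul_cancel_left₀ hd.ne', inv_eq_one_div]
        gcongr
        linarith
    _ = _ := by
        have hxn' : ‖(x : ℂ)‖ < 1 := by rwa [hxn]
        rw [lintegral_const_mul _ (measurable_poissonDensity hxn'),
          lintegral_poissonDensity hxn', mul_one]

/-- The radial weight is a Carleson measure of exponent `γ q`, so the Carleson integral estimate
applies with `b = (m - 1/p) q`. As `1/p ≤ 1`, the condition `γ + 1 < m` makes `b` large enough for
every `p`. -/
theorem exists_mixedNorm_testFun_le {p q : ℝ≥0∞} (hp : 1 ≤ p) (hp' : p < ∞) (hq : 0 < q)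
    (hq' : q < ∞) {γ m : ℝ} (hγ : 0 < γ) (hm : 2 ≤ m) (hγm : γ + 1 < m) :
    ∃ C : ℝ≥0, ∀ ρ ∈ Ico (0 : ℝ) 1,
      mixedNorm p q γ (testFun ρ m) ≤ C * discWeight (γ + 1 / p.toReal - m) ρ := by
  have hQ : 0 < q.toReal := ENNReal.toReal_pos hq.ne' hq'.ne
  have hP : 1 ≤ p.toReal := by simpa using ENNReal.toReal_mono hp'.ne hp
  set Q := q.toReal
  set P := p.toReal
  have hP1 : 1 / P ≤ 1 := by rw [div_le_one (by linarith)]; exact hP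
  have hγQ : 0 < γ * Q := mul_pos hγ hQ
  have hν : (volume.restrict (Ioo (0 : ℝ) 1)).withDensity (discWeight (γ * Q - 1))
      (Ico (0 : ℝ) 1)ᶜ = 0 := by
    refine withDensity_absolutelyContinuous _ _ ?_
    rw [Measure.restrict_apply measurableSet_Ico.compl]
    have : (Ico (0 : ℝ) 1)ᶜ ∩ Ioo 0 1 = ∅ := by
      ext x; simp only [mem_inter_iff, mem_compl_iff, mem_Ico, mem_Ioo, mem_empty_iff_false]; grind
    simp [this]
  obtain ⟨C, hC⟩ := (isCarleson_withDensity_discWeight hγQ).exists_lintegral_le hν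
    (b := (m - 1 / P) * Q) hγQ.le (mul_lt_mul_of_pos_right (by linarith) hQ)
  refine ⟨C ^ (1 / Q), fun ρ hρ => ?_⟩
  rw [mixedNorm_of_ne_top hq'.ne]
  calc (∫⁻ r in Ioo (0 : ℝ) 1,
        discWeight (γ * Q - 1) r * integralMean p (testFun ρ m) r ^ Q) ^ (1 / Q)
      ≤ (∫⁻ r in Ioo (0 : ℝ) 1,
        discWeight (γ * Q - 1) r * discWeight (-((m - 1 / P) * Q)) (r * ρ)) ^ (1 / Q) := by
        refine ENNReal.rpow_le_rpow (setLIntegral_mono' measurableSet_Ioo fun r hr => ?_)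
          (by positivity)
        refine mul_le_mul_right ?_ _
        have hr1 : r * ρ < 1 := by nlinarith [hr.1, hr.2, hρ.1, hρ.2]
        refine (ENNReal.rpow_le_rpow (integralMean_testFun_le hρ hm hp hp'
          (Ioo_subset_Ico_self hr)) hQ.le).trans_eq ?_
        rw [discWeight_rpow hr1 _ hQ.le]
        congr 1; ring
    _ ≤ (C * discWeight ((γ + 1 / P - m) * Q) ρ) ^ (1 / Q) := by
        refine ENNReal.rpow_le_rpow ?_ (by positivity)
        have h := hC ρ hρ
        rw [lintegral_withDensity_eq_lintegral_mul _ (measurable_discWeight _) (by fun_prop)] at h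
        refine h.trans_eq ?_
        congr 2; ring
    _ = _ := by
        rw [ENNReal.mul_rpow_of_nonneg _ _ (by positivity), discWeight_rpow hρ.2 _ (by positivity),
          ENNReal.coe_rpow_of_nonneg _ (by positivity), mul_assoc, mul_one_div_cancel hQ.ne',
          mul_one]

/-! ### Necessity of the Carleson condition -/

section Necessity

variable {μ : Measure ℝ} [IsFiniteMeasure μ]

/-- At the real point `z = ρ` the integrand is positive, so nothing cancels and the integral may be
restricted to `[ρ, 1)`. There both bases, `1 - t ρ²` and `1 - t ρ`, are at most `3 (1 - ρ)`. -/
lemma le_enorm_cesaroOp_testFun (hμ : μ (Ico (0 : ℝ) 1)ᶜ = 0) {β m ρ : ℝ} (hβ : 0 ≤ β)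
    (hm : 0 ≤ m) (hρ : ρ ∈ Ico (0 : ℝ) 1) :
    ENNReal.ofReal (3 ^ (-(m + β))) * discWeight (-(m + β)) ρ * μ (Ico ρ 1)
      ≤ ‖cesaroOp μ β (testFun ρ m) ρ‖ₑ := by
  obtain ⟨h0, h1⟩ := hρ
  have hd : 0 < 1 - ρ := by linarith
  set k : ℝ → ℝ := fun t => (1 - ρ * (t * ρ)) ^ (-m) * (1 - t * ρ) ^ (-β) with hk
  have hbase : ∀ t ∈ Ico (0 : ℝ) 1, 1 - ρ ≤ 1 - ρ * (t * ρ) ∧ 1 - ρ ≤ 1 - t * ρ := by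
    intro t ht
    have h2 : t * ρ ≤ ρ := mul_le_of_le_one_left h0 ht.2.le
    have h3 : 0 ≤ t * ρ := mul_nonneg ht.1 h0
    exact ⟨by nlinarith, by linarith⟩
  have hk0 : ∀ᵐ t ∂μ, 0 ≤ k t := by
    filter_upwards [ae_mem_Ico hμ] with t ht
    obtain ⟨h2, h3⟩ := hbase t ht
    exact mul_nonneg (Real.rpow_nonneg (by linarith) _) (Real.rpow_nonneg (by linarith) _)
  have hval : cesaroOp μ β (testFun ρ m) ρ = ((∫ t, k t ∂μ : ℝ) : ℂ) := by
    rw [cesaroOp, ← integral_complex_ofReal]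
    refine integral_congr_ae ?_
    filter_upwards [ae_mem_Ico hμ] with t ht
    obtain ⟨h2, h3⟩ := hbase t ht
    rw [hk, Complex.ofReal_mul, Complex.ofReal_cpow (by linarith),
      Complex.ofReal_cpow (by linarith), div_eq_mul_inv, ← Complex.cpow_neg, testFun]
    push_cast
    rfl
  have hint : Integrable k μ := by
    refine Integrable.of_bound (C := (1 - ρ) ^ (-m) * (1 - ρ) ^ (-β))
      (Measurable.aestronglyMeasurable (by rw [hk]; fun_prop)) ?_
    filter_upwards [ae_mem_Ico hμ, hk0] with t ht ht0
    obtain ⟨h2, h3⟩ := hbase t ht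
    rw [Real.norm_of_nonneg ht0]
    exact mul_le_mul (Real.rpow_le_rpow_of_nonpos hd h2 (by linarith))
      (Real.rpow_le_rpow_of_nonpos hd h3 (by linarith)) (Real.rpow_nonneg (by linarith) _)
      (by positivity)
  rw [hval, ← ofReal_norm, Complex.norm_real, Real.norm_of_nonneg (integral_nonneg_of_ae hk0),
    ofReal_integral_eq_lintegral_ofReal hint hk0, ← setLIntegral_const]
  refine (setLIntegral_mono' measurableSet_Ico fun t ht => ?_).trans (setLIntegral_le_lintegral _ _)
  obtain ⟨h2, h3⟩ := hbase t ⟨h0.trans ht.1, ht.2⟩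
  rw [discWeight, ← ENNReal.ofReal_mul (by positivity),
    ← Real.mul_rpow (by norm_num) hd.le, neg_add, Real.rpow_add (by positivity)]
  have h4 : ρ * ρ ≤ t * ρ := mul_le_mul_of_nonneg_right ht.1 h0
  have h5 : ρ * (ρ * ρ) ≤ ρ * (t * ρ) := mul_le_mul_of_nonneg_left h4 h0
  have h6 : 1 - ρ * ρ ≤ 2 * (1 - ρ) := by nlinarith
  have h7 : 1 - ρ * (ρ * ρ) ≤ 3 * (1 - ρ) := by nlinarith [mul_nonneg h0 h0]
  exact ENNReal.ofReal_le_ofReal (mul_le_mul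
    (Real.rpow_le_rpow_of_nonpos (by linarith) (by linarith) (by linarith))
    (Real.rpow_le_rpow_of_nonpos (by linarith) (by linarith) (by linarith))
    (by positivity) (Real.rpow_nonneg (by linarith) _))

lemma isCarleson_of_enorm_cesaroOp_testFun_le (hμ : μ (Ico (0 : ℝ) 1)ᶜ = 0) {β m e : ℝ}
    (hβ : 0 ≤ β) (hm : 0 ≤ m) {K : ℝ≥0}
    (hK : ∀ ρ ∈ Ico (0 : ℝ) 1, ‖cesaroOp μ β (testFun ρ m) ρ‖ₑ ≤ K * discWeight e ρ) :
    IsCarleson μ (e + (m + β)) := by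
  -- The summand `1` keeps the constant positive when `K = 0`.
  refine ⟨3 ^ (m + β) * K + 1, by positivity, fun ρ hρ => ?_⟩
  have h := (le_enorm_cesaroOp_testFun hμ hβ hm hρ).trans (hK ρ hρ)
  have h3 : ENNReal.ofReal (3 ^ (m + β)) * ENNReal.ofReal (3 ^ (-(m + β))) = 1 := by
    rw [← ENNReal.ofReal_mul (by positivity), ← Real.rpow_add (by norm_num)]; simp
  calc μ (Ico ρ 1)
      = (ENNReal.ofReal (3 ^ (m + β)) * ENNReal.ofReal (3 ^ (-(m + β)))) *
          (discWeight (m + β) ρ * discWeight (-(m + β)) ρ) * μ (Ico ρ 1) := by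
        rw [h3, discWeight_mul_neg hρ.2, one_mul, one_mul]
    _ = (ENNReal.ofReal (3 ^ (m + β)) * discWeight (m + β) ρ) *
          (ENNReal.ofReal (3 ^ (-(m + β))) * discWeight (-(m + β)) ρ * μ (Ico ρ 1)) := by ring
    _ ≤ (ENNReal.ofReal (3 ^ (m + β)) * discWeight (m + β) ρ) * (K * discWeight e ρ) :=
        mul_le_mul_right h _
    _ = ENNReal.ofReal (3 ^ (m + β)) * K * (discWeight e ρ * discWeight (m + β) ρ) := by ring
    _ = ENNReal.ofReal (3 ^ (m + β) * K * (1 - ρ) ^ (e + (m + β))) := by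
        have hd : 0 ≤ 1 - ρ := by linarith [hρ.2]
        rw [discWeight_mul hρ.2, ENNReal.ofReal_mul (by positivity),
          ENNReal.ofReal_mul (by positivity), ENNReal.ofReal_coe_nnreal, discWeight]
    _ ≤ _ := by
        have hd : 0 ≤ 1 - ρ := by linarith [hρ.2]
        refine ENNReal.ofReal_le_ofReal (mul_le_mul_of_nonneg_right ?_ (by positivity))
        linarith

theorem isCarleson_of_isBoundedBetween_korenblumNorm (hμ : μ (Ico (0 : ℝ) 1)ᶜ = 0)
    {β γ₁ γ₂ : ℝ} (hβ : 0 < β) (hγ₁ : 0 < γ₁)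
    (h : IsBoundedBetween (cesaroOp μ β) (korenblumNorm γ₁) (korenblumNorm γ₂)) :
    IsCarleson μ (β + γ₁ - γ₂) := by
  obtain ⟨C, hC⟩ := h
  rw [show β + γ₁ - γ₂ = -γ₂ + (γ₁ + β) by ring]
  refine isCarleson_of_enorm_cesaroOp_testFun_le hμ hβ.le hγ₁.le (K := C) fun ρ hρ => ?_
  have h1 := korenblumNorm_testFun_le hρ hγ₁.le
  have h2 := (hC _ (holDisc_testFun hρ γ₁) (h1.trans_lt ENNReal.one_lt_top)).2
  have hn : ‖(ρ : ℂ)‖ = ρ := by rw [Complex.norm_real, Real.norm_of_nonneg hρ.1]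
  have h3 : discWeight γ₂ ρ * ‖cesaroOp μ β (testFun ρ γ₁) ρ‖ₑ ≤ C := by
    have h4 := le_iSup₂ (f := fun z (_ : z ∈ Metric.ball (0 : ℂ) 1) =>
      ENNReal.ofReal ((1 - ‖z‖) ^ γ₂) * ‖cesaroOp μ β (testFun ρ γ₁) z‖ₑ) (ρ : ℂ)
      (by rw [mem_ball_zero_iff, hn]; exact hρ.2)
    simp only [hn] at h4
    refine h4.trans (h2.trans ?_)
    exact (mul_le_mul_right h1 _).trans_eq (mul_one _)
  calc ‖cesaroOp μ β (testFun ρ γ₁) ρ‖ₑ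
      = (discWeight γ₂ ρ * ‖cesaroOp μ β (testFun ρ γ₁) ρ‖ₑ) * discWeight (-γ₂) ρ := by
        rw [mul_right_comm, discWeight_mul_neg hρ.2, one_mul]
    _ ≤ _ := mul_le_mul_left h3 _

theorem isCarleson_of_isBoundedBetween_mixedNorm (hμ : μ (Ico (0 : ℝ) 1)ᶜ = 0)
    {β γ₁ γ₂ : ℝ} (hβ : 0 < β) (hγ₁ : 0 < γ₁) (hγ₂ : 0 < γ₂) {p q : ℝ≥0∞} (hp : 1 ≤ p)
    (hp' : p < ∞) (hq : 0 < q) (hq' : q < ∞)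
    (h : IsBoundedBetween (cesaroOp μ β) (mixedNorm p q γ₁) (mixedNorm p q γ₂)) :
    IsCarleson μ (β + γ₁ - γ₂) := by
  obtain ⟨C, hC⟩ := h
  -- The exponent `γ₁ + 2` exceeds both `2` and `γ₁ + 1`. The `1/p` in the norm of the test function
  -- cancels the one in the growth estimate, leaving `-γ₂ - 2`, independent of `p`.
  obtain ⟨A, hA⟩ := exists_mixedNorm_testFun_le hp hp' hq hq' hγ₁ (m := γ₁ + 2) (by linarith)
    (by linarith)
  obtain ⟨B, hB⟩ := exists_enorm_le_mixedNorm hp hp' hq hq' hγ₂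
  rw [show β + γ₁ - γ₂ = (-γ₂ - 2) + ((γ₁ + 2) + β) by ring]
  refine isCarleson_of_enorm_cesaroOp_testFun_le hμ hβ.le (by linarith) (K := B * (C * A))
    fun ρ hρ => ?_
  have h1 := hA ρ hρ
  obtain ⟨h2, h3⟩ := hC _ (holDisc_testFun hρ (γ₁ + 2))
    (h1.trans_lt (ENNReal.mul_lt_top ENNReal.coe_lt_top (discWeight_ne_top _ _).lt_top))
  refine (hB _ h2 ρ hρ).trans ?_
  calc B * mixedNorm p q γ₂ (cesaroOp μ β (testFun ρ (γ₁ + 2))) *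
        discWeight (-(γ₂ + 1 / p.toReal)) ρ
      ≤ B * (C * (A * discWeight (γ₁ + 1 / p.toReal - (γ₁ + 2)) ρ)) *
        discWeight (-(γ₂ + 1 / p.toReal)) ρ :=
        mul_le_mul_left (mul_le_mul_right (h3.trans (mul_le_mul_right h1 _)) _) _
    _ = B * (C * A) * (discWeight (γ₁ + 1 / p.toReal - (γ₁ + 2)) ρ *
        discWeight (-(γ₂ + 1 / p.toReal)) ρ) := by ring
    _ = _ := by
        rw [discWeight_mul hρ.2, ENNReal.coe_mul, ENNReal.coe_mul]
        congr 2; ring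

end Necessity

/-! ### The equivalence -/

theorem theorem6 (μ : Measure ℝ) [IsFiniteMeasure μ] (hμ : μ (Ico (0 : ℝ) 1)ᶜ = 0)
    (γ₁ γ₂ β : ℝ) (hγ₁ : 0 < γ₁) (hγ₂ : 0 < γ₂) (hβ : 0 < β) (hlt : γ₂ < γ₁ + β) :
    List.TFAE [
      IsBoundedBetween (cesaroOp μ β) (korenblumNorm γ₁) (korenblumNorm γ₂),
      IsCarleson μ (β + γ₁ - γ₂),
      ∀ p : ℝ≥0∞, 1 ≤ p →
        IsBoundedBetween (cesaroOp μ β) (mixedNorm p ∞ γ₁) (mixedNorm p ∞ γ₂),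
      ∀ p q : ℝ≥0∞, 1 ≤ p → p < ∞ → 0 < q → q < ∞ →
        IsBoundedBetween (cesaroOp μ β) (mixedNorm p q γ₁) (mixedNorm p q γ₂),
      ∃ p q : ℝ≥0∞, 1 ≤ p ∧ p < ∞ ∧ 0 < q ∧ q < ∞ ∧
        IsBoundedBetween (cesaroOp μ β) (mixedNorm p q γ₁) (mixedNorm p q γ₂),
      ∃ (p q : ℝ≥0∞) (δ : ℝ), 1 ≤ p ∧ p < ∞ ∧ 0 < q ∧ q < ∞ ∧ 0 < δ ∧ δ < γ₁ ∧
        IsBoundedBetween (cesaroOp μ (β + δ)) (mixedNorm p q (γ₁ - δ)) (mixedNorm p q γ₂)] := by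
  tfae_have 1 → 2 := isCarleson_of_isBoundedBetween_korenblumNorm hμ hβ hγ₁
  tfae_have 2 → 1 := isBoundedBetween_korenblumNorm hμ hβ hγ₂ hlt
  tfae_have 2 → 3 := fun h p hp => by
    obtain rfl | hp' := eq_top_or_lt_top p
    · exact isBoundedBetween_mixedNorm_top_top_iff.2
        (isBoundedBetween_korenblumNorm hμ hβ hγ₂ hlt h)
    · exact isBoundedBetween_mixedNorm_top hμ hβ hγ₂ hlt h hp hp'
  tfae_have 3 → 1 := fun h => isBoundedBetween_mixedNorm_top_top_iff.1 (h ∞ le_top)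
  tfae_have 2 → 4 := fun h p q hp hp' hq hq' =>
    isBoundedBetween_mixedNorm hμ hβ hγ₁ hγ₂ hlt h hp hp' hq hq'
  tfae_have 4 → 5 := fun h => ⟨1, 1, le_rfl, ENNReal.one_lt_top, one_pos, ENNReal.one_lt_top,
    h 1 1 le_rfl ENNReal.one_lt_top one_pos ENNReal.one_lt_top⟩
  tfae_have 5 → 2 := fun ⟨_, _, hp, hp', hq, hq', h⟩ =>
    isCarleson_of_isBoundedBetween_mixedNorm hμ hβ hγ₁ hγ₂ hp hp' hq hq' h
  -- Shifting `δ` leaves `β + γ₁` unchanged, so the Carleson exponent is the same and the earlier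
  -- results apply to the shifted parameters. Any `δ` in `(0, γ₁)` would do.
  tfae_have 2 → 6 := fun h => by
    refine ⟨1, 1, γ₁ / 2, le_rfl, ENNReal.one_lt_top, one_pos, ENNReal.one_lt_top, by linarith,
      by linarith, ?_⟩
    refine isBoundedBetween_mixedNorm hμ (by linarith) (by linarith) hγ₂ (by linarith) ?_ le_rfl
      ENNReal.one_lt_top one_pos ENNReal.one_lt_top
    rwa [show β + γ₁ / 2 + (γ₁ - γ₁ / 2) - γ₂ = β + γ₁ - γ₂ by ring]
  tfae_have 6 → 2 := fun ⟨_, _, δ, hp, hp', hq, hq', hδ, hδ', h⟩ => by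
    have h' := isCarleson_of_isBoundedBetween_mixedNorm hμ (by linarith) (by linarith) hγ₂ hp hp'
      hq hq' h
    rwa [show β + δ + (γ₁ - δ) - γ₂ = β + γ₁ - γ₂ by ring] at h'
  tfae_finish
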